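/- Let $m\ge 1$, let $w=(w_\alpha)_{\alpha\in[m]}$ be nonnegative real weights with $|w|=\max_{\alpha\in[m]}w_\alpha$, and let $d=(d_\alpha)_{\alpha\in[m]}$ be integer thresholds. For a random vector $M=(M_\alpha)_{\alpha\in[m]}$ of nonnegative integer counts put $$Y_{ge}=\sum_{\alpha=1}^m w_\alpha \mathbf 1(M_\alpha\ge d_\alpha),\qquad Y_{ne}=\sum_{\alpha=1}^m w_\alpha \mathbf 1(M_\alpha\neq d_\alpha).$$ For a random variable $Y$ and reals $\mu,c>0$, consider the following concentration inequalities: $$P(Y-\mu\le -t)\le \exp\Big(-\frac{t^2}{2c\mu}\Big)\quad\text{for all } t>0,$$ $$P(Y-\mu\ge t)\le \exp\Big(-\frac{t^2}{2c\mu+ct}\Big)\quad\text{for all } t>0,$$ $$P(Y-\mu\ge t)\le \Big(\frac{\mu}{\mu+t}\Big)^{(t+\mu)/c}e^{t/c}\quad\text{for all } t\ge 0,$$ $$P(Y-\mu\le t)\le \Big(\frac{\mu}{\mu+t}\Big)^{(t+\mu)/c}e^{t/c}\quad\text{for all } -\mu\le t\le 0,$$ $$P(Y-\mu\ge t)\le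 \exp\Big(-\frac{t^2}{2c\mu+2ct/3}\Big)\quad\text{for all } t>0,$$ where at $t=-\mu$ the right-hand side of the fourth inequality is read as $e^{-\mu/c}$. In each of the following two models, $EY_{ge}=\mu_{ge}$ and $EY_{ne}=\mu_{ne}$ with the values $\mu_{ge},\mu_{ne}$ given below; if $\mu_{ge}>0$, then all the inequalities hold for $Y=Y_{ge}$, $\mu=\mu_{ge}$, $c=|w|$, and if $\mu_{ne}>0$, then all of them hold for $Y=Y_{ne}$, $\mu=\mu_{ne}$, $c=2|w|$. 1. Multinomial occupancy. Here $n\ge 0$ balls are placed independently into $m$ urns, the location $L_j$ of ball $j$ being urn $\alpha$ with probability $p_{\alpha,j}$, and $M_\alpha=\sum_{j=1}^n\mathbf 1(L_j=\alpha)$. The means are $$\mu_{ge}=\sum_{\alpha=1}^m w_\alpha\sum_{k=d_\alpha}^{n} q_{eq}(k,p_\alpha),\qquad \mu_{ne}=\sum_{\alpha=1}^m w_\alpha\big(1-q_{eq}(d_\alpha,p_\alpha)\big),$$ where $p_\alpha=(p_{\alpha,j})_{j\in[n]}$ and $q_{eq}(k,p)=\sum_{s\subset[n],\,|s|=k}\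 \prod_{j\in s}p_j\prod_{j\notin s}(1-p_j)$. 2. Multivariate hypergeometric sampling. An urn contains $n=\sum_{\alpha}n_\alpha$ balls, $n_\alpha\geq 1$ of which have color $\alpha\in[m]$; a set of $s$ distinct balls, $0\le s\le n$, is drawn uniformly at random (without replacement), and $M_\alpha$ is the number of balls of color $\alpha$ drawn. The means are $$\mu_{ge}=\sum_{\alpha=1}^m w_\alpha\sum_{j\ge d_\alpha} q(j;n_\alpha,s,n),\qquad \mu_{ne}=\sum_{\alpha=1}^m w_\alpha\sum_{j\ne d_\alpha} q(j;n_\alpha,s,n),$$ where $q(j;k,\ell,i)=\binom{k}{j}\binom{i-k}{\ell-j}\big/\binom{i}{\ell}$, and $q(j;k,\ell,i)=0$ when these binomial coefficients are not defined. -/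

import Mathlib

open MeasureTheory ProbabilityTheory

noncomputable section

namespace Occupancy

/-- The weighted number `Y_ge = ∑ w_α 1(M_α ≥ d_α)` of components of the count vector `M` that
are at least their threshold. -/
def Yge {Ω : Type*} {m : ℕ} (w : Fin m → ℝ) (d : Fin m → ℤ) (M : Fin m → Ω → ℕ) (ω : Ω) : ℝ :=
  ∑ α, w α * (if d α ≤ (M α ω : ℤ) then 1 else 0)

/-- The weighted number `Y_ne = ∑ w_α 1(M_α ≠ d_α)` of components of the count vector `M` that
differ from their threshold. -/
def Yne {Ω : Type*} {m : ℕ} (w : Fin m → ℝ) (d : Fin m → ℤ) (M : Fin m → Ω → ℕ) (ω : Ω) : ℝ :=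
  ∑ α, w α * (if (M α ω : ℤ) ≠ d α then 1 else 0)

/-- The maximal weight `|w| = max_α w_α`. -/
def maxWeight {m : ℕ} (w : Fin m → ℝ) : ℝ := ⨆ α, w α

/-- The concentration inequalities for `Y` around `μ` with constant `c`: the sub-Gaussian lower
tail, the sub-exponential upper tail, the two sub-Poisson tails, and the Bernstein upper tail.
At `t = -μ` the sub-Poisson bound reads `(μ / 0) ^ 0 * exp (-μ / c) = exp (-μ / c)`, which is its
limit as `t` decreases to `-μ`. -/
structure ConcentrationBounds {Ω : Type*} [MeasurableSpace Ω] (P : Measure Ω)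
    (Y : Ω → ℝ) (μ c : ℝ) : Prop where
  lower : ∀ t : ℝ, 0 < t →
    P.real {ω | Y ω - μ ≤ -t} ≤ Real.exp (-(t ^ 2 / (2 * c * μ)))
  upper : ∀ t : ℝ, 0 < t →
    P.real {ω | t ≤ Y ω - μ} ≤ Real.exp (-(t ^ 2 / (2 * c * μ + c * t)))
  poisson_upper : ∀ t : ℝ, 0 ≤ t →
    P.real {ω | t ≤ Y ω - μ} ≤ (μ / (μ + t)) ^ ((t + μ) / c) * Real.exp (t / c)
  poisson_lower : ∀ t : ℝ, -μ ≤ t → t ≤ 0 →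
    P.real {ω | Y ω - μ ≤ t} ≤ (μ / (μ + t)) ^ ((t + μ) / c) * Real.exp (t / c)
  bernstein_upper : ∀ t : ℝ, 0 < t →
    P.real {ω | t ≤ Y ω - μ} ≤ Real.exp (-(t ^ 2 / (2 * c * μ + 2 * c * t / 3)))

/-! ### Multinomial occupancy -/

/-- `n` balls are placed independently into `m` urns; `L j` is the location of ball `j`, and it
is urn `α` with probability `p α j`. -/
structure IsMultinomialOccupancy {Ω : Type*} [MeasurableSpace Ω] (P : Measure Ω) {m n : ℕ}
    (p : Fin m → Fin n → ℝ) (L : Fin n → Ω → Fin m) : Prop where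
  measurable : ∀ j, Measurable (L j)
  indep : iIndepFun L P
  law : ∀ α j, P.real {ω | L j ω = α} = p α j

/-- The number of balls in urn `α`. -/
def urnCount {Ω : Type*} {m n : ℕ} (L : Fin n → Ω → Fin m) (α : Fin m) (ω : Ω) : ℕ :=
  (Finset.univ.filter fun j => L j ω = α).card

/-- The Poisson binomial point probability: the probability that exactly `k` of `n` independent
Bernoulli variables with success probabilities `p j` are equal to one. -/
def pbEq {n : ℕ} (k : ℤ) (p : Fin n → ℝ) : ℝ :=
  ∑ s ∈ Finset.univ.filter (fun s : Finset (Fin n) => (s.card : ℤ) = k),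
    (∏ j ∈ s, p j) * ∏ j ∈ sᶜ, (1 - p j)

/-- The Poisson binomial tail probability. -/
def pbGe {n : ℕ} (d : ℤ) (p : Fin n → ℝ) : ℝ := ∑ k ∈ Finset.Icc d (n : ℤ), pbEq k p

/-- The Poisson binomial probability of differing from `d`. -/
def pbNe {n : ℕ} (d : ℤ) (p : Fin n → ℝ) : ℝ := 1 - pbEq d p

/-- The mean of `Y_ge` in the multinomial model. -/
def multinomialMeanGe {m n : ℕ} (w : Fin m → ℝ) (d : Fin m → ℤ) (p : Fin m → Fin n → ℝ) : ℝ :=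
  ∑ α, w α * pbGe (d α) (p α)

/-- The mean of `Y_ne` in the multinomial model. -/
def multinomialMeanNe {m n : ℕ} (w : Fin m → ℝ) (d : Fin m → ℤ) (p : Fin m → Fin n → ℝ) : ℝ :=
  ∑ α, w α * pbNe (d α) (p α)

/-! ### Multivariate hypergeometric sampling -/

/-- The balls of an urn that holds `N α` balls of each color `α`; the first component of a ball is
its color. -/
abbrev Ball {m : ℕ} (N : Fin m → ℕ) : Type := Σ α : Fin m, Fin (N α)

/-- `S` is a uniformly random set of `s` distinct balls, that is, a sample of size `s` taken
without replacement from an urn that holds `N α > 0` balls of each color `α`. -/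
structure IsHypergeometricSample {Ω : Type*} [MeasurableSpace Ω] (P : Measure Ω) {m : ℕ}
    (N : Fin m → ℕ) (s : ℕ) (S : Ω → Finset (Ball N)) : Prop where
  pos : ∀ α, 0 < N α
  size_le : s ≤ ∑ α, N α
  measurable : ∀ A, MeasurableSet {ω | S ω = A}
  law : ∀ A : Finset (Ball N), A.card = s →
    P.real {ω | S ω = A} = 1 / ((∑ α, N α).choose s : ℝ)

/-- The number of balls of color `α` in the sample. -/
def colorCount {Ω : Type*} {m : ℕ} {N : Fin m → ℕ} (S : Ω → Finset (Ball N)) (α : Fin m)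
    (ω : Ω) : ℕ :=
  ((S ω).filter fun b => b.1 = α).card

/-- The hypergeometric point probability
`q(j; k, l, i) = (k choose j) (i - k choose l - j) / (i choose l)`, with value `0` when a binomial
coefficient is undefined (the other out-of-range cases vanish by the value of `Nat.choose`). -/
def hyperQ (j k l i : ℕ) : ℝ :=
  if j ≤ l ∧ k ≤ i then
    (k.choose j : ℝ) * ((i - k).choose (l - j) : ℝ) / (i.choose l : ℝ)
  else 0

/-- The mean of `Y_ge` in the hypergeometric model (`hyperQ` vanishes for `j > s`). -/
def hyperMeanGe {m : ℕ} (w : Fin m → ℝ) (d : Fin m → ℤ) (N : Fin m → ℕ) (s : ℕ) : ℝ :=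
  ∑ α, w α * ∑ j ∈ (Finset.range (s + 1)).filter (fun j : ℕ => d α ≤ (j : ℤ)),
    hyperQ j (N α) s (∑ β, N β)

/-- The mean of `Y_ne` in the hypergeometric model (`hyperQ` vanishes for `j > s`). -/
def hyperMeanNe {m : ℕ} (w : Fin m → ℝ) (d : Fin m → ℤ) (N : Fin m → ℕ) (s : ℕ) : ℝ :=
  ∑ α, w α * ∑ j ∈ (Finset.range (s + 1)).filter (fun j : ℕ => (j : ℤ) ≠ d α),
    hyperQ j (N α) s (∑ β, N β)

end Occupancy

end

open MeasureTheory ProbabilityTheory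

noncomputable section

namespace Occupancy

/-! ### Concentration from a sub-Poisson moment generating function -/

/-! Let `m(θ) = E exp(θY)`. Everything reduces to the differential inequality `m' ≤ μ exp(cθ) m` for
`θ ≥ 0`, reversed for `θ ≤ 0`. Integrated from `0` (`sum_exp_le_of_sizeBias`), it bounds `m` by the
moment generating function of `c` times a Poisson variable of mean `μ / c`, and Chernoff's method
gives all five tails (`ConcentrationBounds.of_mgf_le`). Since `m'` is the sum of `w α * E[1_α
exp(θY)]`, it suffices that conditioning on one indicator `1_α` costs at most a factor `exp(cθ)`.
This is a size-bias coupling argument with each coupling replaced by an inequality between sums.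

Both models share one structure, `ColorSplit`. Let `R` be the random set of balls that are in the
picture but not of color `α`: the count of `α` is `T - |R|`, and the other counts are read off from
`R`. The law of `R` is a product of Bernoulli weights times a log-concave function of `|R|`. Two
facts about such sets carry the proof. The cardinality is log-concave (`isLogConcave_levelSum`), and
passing from cardinality `r` to `r + 1` amounts, for means, to adding one element
(`levelSum_succ_mul_le`).

For `≥`, the count of `α` decreases and the other counts increase with `R`, so Chebyshev's sum
inequality gives negative association; the indicator's own term costs `w α ≤ |w|`. For `≠`, a
log-concave law and its conditioning on `r ≠ d` differ by at most one step (`sum_ne_mul_sum_le`).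
One step changes the count of `α` and one other count, hence `Y` by at most `2|w|`. -/

lemma exp_neg_le_quadratic {x : ℝ} (hx : 0 ≤ x) : Real.exp (-x) ≤ 1 - x + x ^ 2 / 2 := by
  have hd : ∀ u : ℝ, HasDerivAt (fun u : ℝ => 1 - u + u ^ 2 / 2 - Real.exp (-u))
      (-1 + u + Real.exp (-u)) u := fun u => by
    have h := ((((hasDerivAt_id u).const_sub 1).add (((hasDerivAt_id u).pow 2).div_const 2)).sub
      (hasDerivAt_id u).neg.exp)
    refine h.congr_deriv ?_
    simp
  have hm : MonotoneOn (fun u : ℝ => 1 - u + u ^ 2 / 2 - Real.exp (-u)) (Set.Ici 0) := by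
    refine monotoneOn_of_deriv_nonneg (convex_Ici 0)
      (fun u _ => (hd u).continuousAt.continuousWithinAt)
      (fun u _ => (hd u).differentiableAt.differentiableWithinAt) fun u _ => ?_
    rw [(hd u).deriv]
    linarith [Real.add_one_le_exp (-u)]
  have := hm (Set.mem_Ici.2 le_rfl) (Set.mem_Ici.2 hx) hx
  simp at this
  linarith

/-- This is `exp x ≤ 1 + x + (x² / 2) / (1 - x / 3)` with the denominator cleared, the estimate
behind Bernstein's bound. Two differentiations reduce it to `1 - u ≤ exp (-u)`. -/
lemma exp_mul_le_quadratic {x : ℝ} (hx : 0 ≤ x) :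
    Real.exp x * (1 - x / 3) ≤ 1 + 2 * x / 3 + x ^ 2 / 6 := by
  have hd' : ∀ u : ℝ, HasDerivAt (fun u : ℝ => 2 + u - Real.exp u * (2 - u))
      (1 - Real.exp u * (1 - u)) u := fun u => by
    have h := (((hasDerivAt_id u).const_add 2).sub
      ((Real.hasDerivAt_exp u).mul ((hasDerivAt_id u).const_sub 2)))
    refine h.congr_deriv ?_
    simp
    ring
  have hm' : MonotoneOn (fun u : ℝ => 2 + u - Real.exp u * (2 - u)) (Set.Ici 0) := by
    refine monotoneOn_of_deriv_nonneg (convex_Ici 0)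
      (fun u _ => (hd' u).continuousAt.continuousWithinAt)
      (fun u _ => (hd' u).differentiableAt.differentiableWithinAt) fun u _ => ?_
    rw [(hd' u).deriv]
    have h1 := mul_le_mul_of_nonneg_left (Real.add_one_le_exp (-u)) (Real.exp_pos u).le
    rw [← Real.exp_add, add_neg_cancel, Real.exp_zero] at h1
    linarith
  have hd : ∀ u : ℝ, HasDerivAt
      (fun u : ℝ => 1 + 2 * u / 3 + u ^ 2 / 6 - Real.exp u * (1 - u / 3))
      ((2 + u - Real.exp u * (2 - u)) / 3) u := fun u => by
    have h := ((((((hasDerivAt_id u).const_mul 2).div_const 3).const_add 1).add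
      (((hasDerivAt_id u).pow 2).div_const 6))).sub
      ((Real.hasDerivAt_exp u).mul (((hasDerivAt_id u).div_const 3).const_sub 1))
    refine h.congr_deriv ?_
    simp
    ring
  have hm : MonotoneOn (fun u : ℝ => 1 + 2 * u / 3 + u ^ 2 / 6 - Real.exp u * (1 - u / 3))
      (Set.Ici 0) := by
    refine monotoneOn_of_deriv_nonneg (convex_Ici 0)
      (fun u _ => (hd u).continuousAt.continuousWithinAt)
      (fun u _ => (hd u).differentiableAt.differentiableWithinAt) fun u hu => ?_
    rw [(hd u).deriv]
    have hu' : (0 : ℝ) ≤ u := by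
      rw [interior_Ici] at hu
      exact le_of_lt hu
    have := hm' (Set.mem_Ici.2 le_rfl) (Set.mem_Ici.2 hu') hu'
    simp only [Real.exp_zero] at this
    linarith
  have := hm (Set.mem_Ici.2 le_rfl) (Set.mem_Ici.2 hx) hx
  simp at this
  linarith

/-- A random variable whose moment generating function is at most that of `c` times a Poisson
variable of mean `μ / c` satisfies all the concentration bounds. -/
theorem ConcentrationBounds.of_mgf_le {Ω : Type*} [MeasurableSpace Ω] {P : Measure Ω}
    [IsProbabilityMeasure P] {Y : Ω → ℝ} {μ c : ℝ} (hμ : 0 < μ) (hc : 0 < c)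
    (hint : ∀ θ, Integrable (fun ω => Real.exp (θ * Y ω)) P)
    (hmgf : ∀ θ, mgf Y P θ ≤ Real.exp (μ / c * (Real.exp (c * θ) - 1))) :
    ConcentrationBounds P Y μ c := by
  -- Chernoff's bound at `θ = x / c`; this scaling leaves `c` only as an overall divisor of the
  -- exponent.
  have hup : ∀ t x : ℝ, 0 ≤ x → P.real {ω | t ≤ Y ω - μ} ≤
      Real.exp ((μ * (Real.exp x - 1) - x * (μ + t)) / c) := by
    intro t x hx
    have h := measure_ge_le_exp_mul_mgf (X := Y) (μ := P) (μ + t) (t := x / c)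
      (by positivity) (hint _)
    have hs : {ω | t ≤ Y ω - μ} = {ω | μ + t ≤ Y ω} := by
      ext ω
      simp only [Set.mem_ofPred_eq]
      constructor <;> intro h <;> linarith
    rw [hs]
    refine h.trans ((mul_le_mul_of_nonneg_left (hmgf _) (Real.exp_pos _).le).trans (le_of_eq ?_))
    rw [← Real.exp_add, mul_div_cancel₀ x hc.ne']
    congr 1
    field_simp
    ring
  have hlow : ∀ t x : ℝ, x ≤ 0 → P.real {ω | Y ω - μ ≤ t} ≤
      Real.exp ((μ * (Real.exp x - 1) - x * (μ + t)) / c) := by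
    intro t x hx
    have h := measure_le_le_exp_mul_mgf (X := Y) (μ := P) (μ + t) (t := x / c)
      (div_nonpos_of_nonpos_of_nonneg hx hc.le) (hint _)
    have hs : {ω | Y ω - μ ≤ t} = {ω | Y ω ≤ μ + t} := by
      ext ω
      simp only [Set.mem_ofPred_eq]
      constructor <;> intro h <;> linarith
    rw [hs]
    refine h.trans ((mul_le_mul_of_nonneg_left (hmgf _) (Real.exp_pos _).le).trans (le_of_eq ?_))
    rw [← Real.exp_add, mul_div_cancel₀ x hc.ne']
    congr 1
    field_simp
    ring
  -- `x = log ((μ + t) / μ)` minimizes the exponent.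
  have hpois : ∀ t : ℝ, 0 < μ + t →
      Real.exp ((μ * (Real.exp (Real.log ((μ + t) / μ)) - 1) -
        Real.log ((μ + t) / μ) * (μ + t)) / c) =
      (μ / (μ + t)) ^ ((t + μ) / c) * Real.exp (t / c) := by
    intro t ht
    rw [Real.exp_log (by positivity), Real.rpow_def_of_pos (by positivity), ← Real.exp_add,
      ← inv_div (μ + t) μ, Real.log_inv]
    congr 1
    field_simp
    ring
  have hbern : ∀ t : ℝ, 0 < t →
      P.real {ω | t ≤ Y ω - μ} ≤ Real.exp (-(t ^ 2 / (2 * c * μ + 2 * c * t / 3))) := by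
    intro t ht
    -- With this `x`, `1 - x / 3 = μ / (μ + t / 3)`, so the quadratic estimate bounds exactly `μ *
    -- exp x`.
    have hx : 0 ≤ t / (μ + t / 3) := by positivity
    refine (hup t _ hx).trans (Real.exp_le_exp.2 ?_)
    have hD : 0 < μ + t / 3 := by positivity
    have h := exp_mul_le_quadratic hx
    set e := Real.exp (t / (μ + t / 3)) with he
    have h1 : 1 - t / (μ + t / 3) / 3 = μ / (μ + t / 3) := by
      field_simp
      ring
    rw [h1] at h
    have h2 : μ * e ≤ (μ + t / 3) * (1 + 2 * (t / (μ + t / 3)) / 3 + (t / (μ + t / 3)) ^ 2 / 6) := by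
      calc μ * e = (μ + t / 3) * (e * (μ / (μ + t / 3))) := by field_simp
        _ ≤ _ := mul_le_mul_of_nonneg_left h hD.le
    have h3 : -(t ^ 2 / (2 * c * μ + 2 * c * t / 3)) =
        ((μ + t / 3) * (1 + 2 * (t / (μ + t / 3)) / 3 + (t / (μ + t / 3)) ^ 2 / 6) - μ
          - t / (μ + t / 3) * (μ + t)) / c := by
      field_simp
      ring
    rw [h3]
    gcongr
    linarith
  refine ⟨fun t ht => ?_, fun t ht => (hbern t ht).trans (Real.exp_le_exp.2 ?_), fun t ht => ?_,
    fun t ht ht' => ?_, hbern⟩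
  · have hx : 0 ≤ t / μ := by positivity
    refine (hlow (-t) (-(t / μ)) (by linarith)).trans (Real.exp_le_exp.2 ?_)
    have h := mul_le_mul_of_nonneg_left (exp_neg_le_quadratic hx) hμ.le
    have h3 : -(t ^ 2 / (2 * c * μ)) =
        (μ * (1 - t / μ + (t / μ) ^ 2 / 2) - μ + t / μ * (μ - t)) / c := by
      field_simp
      ring
    rw [h3]
    gcongr
    linarith
  · have : 0 < c * t := by positivity
    gcongr
    linarith
  · rw [← hpois t (by linarith)]
    exact hup t _ (Real.log_nonneg (by rw [le_div_iff₀ hμ]; linarith))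
  · rcases ht.eq_or_lt with h | h
    · subst h
      simp only [add_neg_cancel, div_zero, neg_add_cancel, zero_div, Real.rpow_zero, one_mul]
      -- At `t = -μ` the optimal `x` is `-∞`, so the bound is reached as a limit.
      have hl : Filter.Tendsto
          (fun x : ℝ => Real.exp ((μ * (Real.exp x - 1) - x * (μ + -μ)) / c)) Filter.atBot
          (nhds (Real.exp (-μ / c))) := by
        have h1 := ((((Real.tendsto_exp_atBot.sub_const 1).const_mul μ).div_const c)).rexp
        have h2 : μ * (0 - 1) / c = -μ / c := by ring
        rw [h2] at h1
        simpa using h1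
      exact ge_of_tendsto hl ((Filter.eventually_le_atBot 0).mono fun x hx => hlow (-μ) x hx)
    · rw [← hpois t (by linarith)]
      exact hlow t _ (Real.log_nonpos (div_nonneg (by linarith) hμ.le)
        (by rw [div_le_one hμ]; linarith))

/-- The differential inequality `dm/dθ ≤ μ e^{cθ} m` for `θ ≥ 0`, reversed for `θ ≤ 0`, for the moment
generating function `m` of a finitely supported law integrates to the sub-Poisson bound. -/
theorem sum_exp_le_of_sizeBias {A : Type*} [Fintype A] {π y : A → ℝ} {μ c : ℝ} (hc : 0 < c)
    (hsum : ∑ a, π a = 1)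
    (hpos : ∀ θ : ℝ, 0 ≤ θ → ∑ a, π a * (y a * Real.exp (θ * y a)) ≤
      μ * (Real.exp (θ * c) * ∑ a, π a * Real.exp (θ * y a)))
    (hneg : ∀ θ : ℝ, θ ≤ 0 → μ * (Real.exp (θ * c) * ∑ a, π a * Real.exp (θ * y a)) ≤
      ∑ a, π a * (y a * Real.exp (θ * y a))) (θ : ℝ) :
    ∑ a, π a * Real.exp (θ * y a) ≤ Real.exp (μ / c * (Real.exp (c * θ) - 1)) := by
  -- The moment generating function divided by the claimed bound: `g 0 = 1`, and `g` increases up to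
  -- `0` and decreases after it.
  set g : ℝ → ℝ := fun θ => (∑ a, π a * Real.exp (θ * y a)) *
    Real.exp (-(μ / c * (Real.exp (c * θ) - 1))) with hg
  have hd : ∀ θ, HasDerivAt g ((∑ a, π a * (y a * Real.exp (θ * y a)) -
      μ * (Real.exp (θ * c) * ∑ a, π a * Real.exp (θ * y a))) *
      Real.exp (-(μ / c * (Real.exp (c * θ) - 1)))) θ := by
    intro θ
    have h1 : HasDerivAt (fun θ : ℝ => ∑ a, π a * Real.exp (θ * y a))
        (∑ a, π a * (Real.exp (θ * y a) * (1 * y a))) θ :=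
      HasDerivAt.fun_sum fun a _ => (((hasDerivAt_id θ).mul_const (y a)).exp).const_mul (π a)
    have h2 : HasDerivAt (fun θ : ℝ => Real.exp (-(μ / c * (Real.exp (c * θ) - 1))))
        (Real.exp (-(μ / c * (Real.exp (c * θ) - 1))) *
          (-(μ / c * (Real.exp (c * θ) * (c * 1))))) θ :=
      (((((hasDerivAt_id θ).const_mul c).exp).sub_const 1).const_mul (μ / c)).neg.exp
    refine (h1.mul h2).congr_deriv ?_
    have h3 : ∑ a, π a * (Real.exp (θ * y a) * (1 * y a)) =
        ∑ a, π a * (y a * Real.exp (θ * y a)) := by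
      refine Finset.sum_congr rfl fun a _ => by ring
    have h4 : μ / c * (Real.exp (c * θ) * (c * 1)) = μ * Real.exp (θ * c) := by
      rw [mul_comm θ c]
      field_simp
    rw [h3, h4]
    ring
  have hg0 : g 0 = 1 := by simp [hg, hsum]
  have hle : g θ ≤ 1 := by
    rw [← hg0]
    rcases le_total 0 θ with h | h
    · refine antitoneOn_of_deriv_nonpos (convex_Ici 0)
        (fun u _ => (hd u).continuousAt.continuousWithinAt)
        (fun u _ => (hd u).differentiableAt.differentiableWithinAt) (fun u hu => ?_)
        (Set.mem_Ici.2 le_rfl) (Set.mem_Ici.2 h) h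
      rw [interior_Ici] at hu
      rw [(hd u).deriv]
      exact mul_nonpos_of_nonpos_of_nonneg (sub_nonpos.2 (hpos u (le_of_lt hu)))
        (Real.exp_pos _).le
    · refine monotoneOn_of_deriv_nonneg (convex_Iic 0)
        (fun u _ => (hd u).continuousAt.continuousWithinAt)
        (fun u _ => (hd u).differentiableAt.differentiableWithinAt) (fun u hu => ?_)
        (Set.mem_Iic.2 h) (Set.mem_Iic.2 le_rfl) h
      rw [interior_Iic] at hu
      rw [(hd u).deriv]
      exact mul_nonneg (sub_nonneg.2 (hneg u (le_of_lt hu))) (Real.exp_pos _).le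
  simp only [hg, Real.exp_neg] at hle
  rwa [← div_eq_mul_inv, div_le_one (Real.exp_pos _)] at hle

/-! ### Log-concave sequences -/

/-- A sequence on `ℤ` is log-concave without internal zeros (for a nonnegative sequence). -/
def IsLogConcave (a : ℤ → ℝ) : Prop :=
  ∀ i j k l : ℤ, i ≤ k → k ≤ j → i + j = k + l → a i * a j ≤ a k * a l

lemma IsLogConcave.mul {a b : ℤ → ℝ} (ha : IsLogConcave a) (hb : IsLogConcave b)
    (ha0 : ∀ i, 0 ≤ a i) (hb0 : ∀ i, 0 ≤ b i) : IsLogConcave fun i => a i * b i := by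
  intro i j k l h1 h2 h3
  calc a i * b i * (a j * b j) = (a i * a j) * (b i * b j) := by ring
    _ ≤ (a k * a l) * (b k * b l) :=
      mul_le_mul (ha i j k l h1 h2 h3) (hb i j k l h1 h2 h3) (mul_nonneg (hb0 _) (hb0 _))
        (mul_nonneg (ha0 _) (ha0 _))
    _ = a k * b k * (a l * b l) := by ring

lemma IsLogConcave.comp_sub {a : ℤ → ℝ} (ha : IsLogConcave a) (T : ℤ) :
    IsLogConcave fun i => a (T - i) := by
  intro i j k l h1 h2 h3
  have := ha (T - j) (T - i) (T - k) (T - l) (by omega) (by omega) (by omega)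
  linarith

lemma IsLogConcave.one : IsLogConcave fun _ => 1 := fun _ _ _ _ _ _ _ => le_rfl

/-! ### Weighted sums over the subsets of a finite set -/

section SubsetSum

variable {ι : Type*} [DecidableEq ι]

/-- The sum of `φ` over the subsets `R` of `s`, weighted by `∏_{i ∈ R} x i ∏_{i ∈ s \ R} y i`. -/
def subsetSum (s : Finset ι) (x y : ι → ℝ) (φ : Finset ι → ℝ) : ℝ :=
  ∑ R ∈ s.powerset, (∏ i ∈ R, x i) * (∏ i ∈ s \ R, y i) * φ R

/-- The part of `subsetSum` that comes from the subsets of cardinality `r`. -/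
def levelSum (s : Finset ι) (x y : ι → ℝ) (r : ℤ) (φ : Finset ι → ℝ) : ℝ :=
  subsetSum s x y fun R => if (R.card : ℤ) = r then φ R else 0

variable {s : Finset ι} {x y : ι → ℝ} {r : ℤ} {φ ψ : Finset ι → ℝ}

lemma subsetSum_congr (h : ∀ R ⊆ s, φ R = ψ R) : subsetSum s x y φ = subsetSum s x y ψ :=
  Finset.sum_congr rfl fun R hR => by rw [h R (Finset.mem_powerset.1 hR)]

lemma subsetSum_weight_nonneg (hx : ∀ i ∈ s, 0 ≤ x i) (hy : ∀ i ∈ s, 0 ≤ y i) {R : Finset ι}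
    (hR : R ⊆ s) : 0 ≤ (∏ i ∈ R, x i) * ∏ i ∈ s \ R, y i :=
  mul_nonneg (Finset.prod_nonneg fun i hi => hx i (hR hi))
    (Finset.prod_nonneg fun i hi => hy i (Finset.sdiff_subset hi))

lemma subsetSum_mono (hx : ∀ i ∈ s, 0 ≤ x i) (hy : ∀ i ∈ s, 0 ≤ y i) (h : ∀ R ⊆ s, φ R ≤ ψ R) :
    subsetSum s x y φ ≤ subsetSum s x y ψ :=
  Finset.sum_le_sum fun R hR => mul_le_mul_of_nonneg_left (h R (Finset.mem_powerset.1 hR))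
    (subsetSum_weight_nonneg hx hy (Finset.mem_powerset.1 hR))

lemma subsetSum_insert {a : ι} (ha : a ∉ s) : subsetSum (insert a s) x y φ =
    y a * subsetSum s x y φ + x a * subsetSum s x y fun R => φ (insert a R) := by
  unfold subsetSum
  rw [Finset.sum_powerset_insert ha, Finset.mul_sum, Finset.mul_sum]
  congr 1
  · refine Finset.sum_congr rfl fun R hR => ?_
    have haR : a ∉ R := fun h => ha (Finset.mem_powerset.1 hR h)
    rw [Finset.insert_sdiff_of_notMem _ haR, Finset.prod_insert (by simp [ha])]
    ring
  · refine Finset.sum_congr rfl fun R hR => ?_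
    have haR : a ∉ R := fun h => ha (Finset.mem_powerset.1 hR h)
    rw [Finset.prod_insert haR, Finset.insert_sdiff_insert, Finset.sdiff_insert_of_notMem ha]
    ring

lemma levelSum_empty : levelSum ∅ x y r φ = if r = 0 then φ ∅ else 0 := by
  simp [levelSum, subsetSum, eq_comm]

lemma levelSum_insert {a : ι} (ha : a ∉ s) : levelSum (insert a s) x y r φ =
    y a * levelSum s x y r φ + x a * levelSum s x y (r - 1) fun R => φ (insert a R) := by
  unfold levelSum
  rw [subsetSum_insert ha]
  congr 2
  refine subsetSum_congr fun R hR => ?_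
  have haR : a ∉ R := fun h => ha (hR h)
  rw [Finset.card_insert_of_notMem haR]
  push_cast
  simp only [eq_sub_iff_add_eq]

lemma levelSum_mono (hx : ∀ i ∈ s, 0 ≤ x i) (hy : ∀ i ∈ s, 0 ≤ y i) (h : ∀ R ⊆ s, φ R ≤ ψ R) :
    levelSum s x y r φ ≤ levelSum s x y r ψ :=
  subsetSum_mono hx hy fun R hR => by
    split_ifs
    exacts [h R hR, le_rfl]

lemma levelSum_neg : levelSum s x y r (fun R => -φ R) = -levelSum s x y r φ := by
  unfold levelSum subsetSum
  rw [← Finset.sum_neg_distrib]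
  refine Finset.sum_congr rfl fun R _ => ?_
  dsimp only
  split_ifs <;> simp

lemma levelSum_one_nonneg (hx : ∀ i ∈ s, 0 ≤ x i) (hy : ∀ i ∈ s, 0 ≤ y i) :
    0 ≤ levelSum s x y r fun _ => 1 :=
  Finset.sum_nonneg fun R hR => mul_nonneg
    (subsetSum_weight_nonneg hx hy (Finset.mem_powerset.1 hR)) (by dsimp only; split_ifs <;> norm_num)

/-- Conditional means on a level appear below only in cross-multiplied form; this settles the levels
of mass zero, where no division is possible. -/
lemma levelSum_eq_zero (hx : ∀ i ∈ s, 0 ≤ x i) (hy : ∀ i ∈ s, 0 ≤ y i)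
    (h : levelSum s x y r (fun _ => 1) = 0) : levelSum s x y r φ = 0 := by
  unfold levelSum subsetSum at h ⊢
  rw [Finset.sum_eq_zero_iff_of_nonneg fun R hR => mul_nonneg
    (subsetSum_weight_nonneg hx hy (Finset.mem_powerset.1 hR)) (by split_ifs <;> norm_num)] at h
  refine Finset.sum_eq_zero fun R hR => ?_
  have := h R hR
  dsimp only at this ⊢
  split_ifs at this ⊢
  · rw [mul_one] at this
    rw [this, zero_mul]
  · rw [mul_zero]

lemma subsetSum_eq_sum_levelSum {I : Finset ℤ} (hI : ∀ R ⊆ s, (R.card : ℤ) ∈ I) (a : ℤ → ℝ) :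
    subsetSum s x y (fun R => a R.card * φ R) = ∑ r ∈ I, a r * levelSum s x y r φ := by
  unfold levelSum subsetSum
  simp_rw [Finset.mul_sum]
  rw [Finset.sum_comm]
  refine Finset.sum_congr rfl fun R hR => ?_
  rw [Finset.sum_eq_single_of_mem _ (hI R (Finset.mem_powerset.1 hR))]
  · simp only [if_true]
    ring
  · intro r _ hr
    rw [if_neg (Ne.symm hr)]
    ring

/-- The level sums are the coefficients of `∏ (y i + x i * t)`, and multiplication by a linear
factor with nonnegative coefficients preserves log-concavity. After expansion, the four products on
each side compare in pairs by the induction hypothesis. -/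
lemma isLogConcave_levelSum (hx : ∀ i ∈ s, 0 ≤ x i) (hy : ∀ i ∈ s, 0 ≤ y i) :
    IsLogConcave fun r => levelSum s x y r fun _ => 1 := by
  induction s using Finset.induction_on with
  | empty =>
    intro i j k l h1 h2 h3
    simp only [levelSum_empty]
    by_cases hi : i = 0
    · by_cases hj : j = 0
      · rw [if_pos hi, if_pos hj, if_pos (by omega), if_pos (by omega)]
      · rw [if_neg hj, mul_zero]
        split_ifs <;> norm_num
    · rw [if_neg hi, zero_mul]
      split_ifs <;> norm_num
  | insert a s ha ih =>
    have ih := ih (fun i hi => hx i (Finset.mem_insert_of_mem hi))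
      (fun i hi => hy i (Finset.mem_insert_of_mem hi))
    have hxa := hx a (Finset.mem_insert_self a s)
    have hya := hy a (Finset.mem_insert_self a s)
    intro i j k l h1 h2 h3
    simp only [levelSum_insert ha]
    -- The mixed comparison `e3` needs `k ≤ j - 1`; for `k = j` both sides agree.
    rcases h2.eq_or_lt with h | h
    · obtain rfl : i = l := by omega
      subst h
      exact (mul_comm _ _).le
    have e1 := ih i j k l h1 h2 h3
    have e2 := ih (i - 1) (j - 1) (k - 1) (l - 1) (by omega) (by omega) (by omega)
    have e3 := ih i (j - 1) k (l - 1) (by omega) (by omega) (by omega)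
    have e4 := ih (i - 1) j (k - 1) l (by omega) (by omega) (by omega)
    simp only at e1 e2 e3 e4
    have m1 := mul_le_mul_of_nonneg_left e1 (mul_nonneg hya hya)
    have m2 := mul_le_mul_of_nonneg_left e2 (mul_nonneg hxa hxa)
    have m3 := mul_le_mul_of_nonneg_left e3 (mul_nonneg hxa hya)
    have m4 := mul_le_mul_of_nonneg_left e4 (mul_nonneg hxa hya)
    linarith

/-- If adding an element takes `φ` to at most `ψ`, then the mean of `φ` over the random subsets of
cardinality `r + 1` is at most the mean of `ψ` over those of cardinality `r`. -/
lemma levelSum_succ_mul_le (hx : ∀ i ∈ s, 0 ≤ x i) (hy : ∀ i ∈ s, 0 ≤ y i)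
    (h : ∀ R ⊆ s, ∀ a ∈ s, a ∉ R → φ (insert a R) ≤ ψ R) :
    levelSum s x y (r + 1) φ * levelSum s x y r (fun _ => 1) ≤
      levelSum s x y (r + 1) (fun _ => 1) * levelSum s x y r ψ := by
  induction s using Finset.induction_on generalizing r φ ψ with
  | empty =>
    simp only [levelSum_empty]
    by_cases hr : r = 0
    · have hr' : ¬ r + 1 = 0 := by omega
      rw [if_neg hr', if_neg hr']
      simp
    · rw [if_neg hr, if_neg hr]
      simp
  | insert a s ha ih =>
    have hx' : ∀ i ∈ s, 0 ≤ x i := fun i hi => hx i (Finset.mem_insert_of_mem hi)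
    have hy' : ∀ i ∈ s, 0 ≤ y i := fun i hi => hy i (Finset.mem_insert_of_mem hi)
    have hxa := hx a (Finset.mem_insert_self a s)
    have hya := hy a (Finset.mem_insert_self a s)
    have ih1 := @ih r φ ψ hx' hy' fun R hR b hb hbR =>
      h R (hR.trans (Finset.subset_insert a s)) b (Finset.mem_insert_of_mem hb) hbR
    have ih2 := @ih (r - 1) (fun R => φ (insert a R)) (fun R => ψ (insert a R)) hx' hy'
      fun R hR b hb hbR => by
        rw [Finset.insert_comm]
        refine h _ (Finset.insert_subset_insert a hR) b (Finset.mem_insert_of_mem hb) ?_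
        simp only [Finset.mem_insert, not_or]
        exact ⟨fun hba => ha (hba ▸ hb), hbR⟩
    have hle : levelSum s x y r (fun R => φ (insert a R)) ≤ levelSum s x y r ψ :=
      levelSum_mono hx' hy' fun R hR => h R (hR.trans (Finset.subset_insert a s)) a
        (Finset.mem_insert_self a s) fun haR => ha (hR haR)
    have hlc := isLogConcave_levelSum hx' hy' (r - 1) (r + 1) r r (by omega) (by omega) (by omega)
    have n1 := levelSum_one_nonneg (r := r + 1) hx' hy'
    have n0 := levelSum_one_nonneg (r := r) hx' hy'
    have n2 := levelSum_one_nonneg (r := r - 1) hx' hy'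
    have z1 := levelSum_eq_zero (r := r + 1) (φ := φ) hx' hy'
    have z0 := levelSum_eq_zero (r := r) (φ := ψ) hx' hy'
    have z0' := levelSum_eq_zero (r := r) (φ := fun R => φ (insert a R)) hx' hy'
    have z2 := levelSum_eq_zero (r := r - 1) (φ := fun R => ψ (insert a R)) hx' hy'
    simp only [levelSum_insert ha, add_sub_cancel_right]
    rw [sub_add_cancel] at ih2
    simp only at hlc
    generalize levelSum s x y (r + 1) φ = A at *
    generalize levelSum s x y r (fun R => φ (insert a R)) = B at *
    generalize levelSum s x y r ψ = C at *
    generalize levelSum s x y (r - 1) (fun R => ψ (insert a R)) = D at *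
    generalize levelSum s x y (r + 1) (fun _ => 1) = E1 at *
    generalize levelSum s x y r (fun _ => 1) = E0 at *
    generalize levelSum s x y (r - 1) (fun _ => 1) = E2 at *
    -- The sums split by whether the subset contains `a`. The `y²` and `x²` terms are the induction
    -- hypotheses; `key` is the mixed term. Multiplied by `E0`, it follows from both hypotheses, `E2
    -- * E1 ≤ E0 * E0` and `B ≤ C`. If `E0 = 0`, log-concavity forces `E1` or `E2` to vanish.
    have key : A * E2 + B * E0 ≤ E1 * D + E0 * C := by
      rcases n0.eq_or_lt with h0 | h0
      · have hE : E2 * E1 = 0 := by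
          subst h0
          exact le_antisymm (by linarith) (mul_nonneg n2 n1)
        rw [z0 h0.symm, z0' h0.symm]
        rcases mul_eq_zero.1 hE with h2 | h2
        · rw [z2 h2, h2]
          simp
        · rw [z1 h2, h2]
          simp
      · refine le_of_mul_le_mul_right ?_ h0
        have k1 := mul_le_mul_of_nonneg_right ih1 n2
        have k2 := mul_le_mul_of_nonneg_right ih2 n1
        have k3 := mul_le_mul_of_nonneg_right hlc (sub_nonneg.2 hle)
        linarith
    have m1 := mul_le_mul_of_nonneg_left ih1 (mul_nonneg hya hya)
    have m2 := mul_le_mul_of_nonneg_left ih2 (mul_nonneg hxa hxa)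
    have m3 := mul_le_mul_of_nonneg_left key (mul_nonneg hxa hya)
    linarith

/-- The mirror image of the previous lemma, obtained by negating both functions, whose signs are
arbitrary. -/
lemma levelSum_mul_succ_le (hx : ∀ i ∈ s, 0 ≤ x i) (hy : ∀ i ∈ s, 0 ≤ y i)
    (h : ∀ R ⊆ s, ∀ a ∈ s, a ∉ R → φ R ≤ ψ (insert a R)) :
    levelSum s x y r φ * levelSum s x y (r + 1) (fun _ => 1) ≤
      levelSum s x y r (fun _ => 1) * levelSum s x y (r + 1) ψ := by
  have := levelSum_succ_mul_le (r := r) (φ := fun R => -ψ R) (ψ := fun R => -φ R) hx hy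
    fun R hR a ha haR => neg_le_neg (h R hR a ha haR)
  rw [levelSum_neg, levelSum_neg] at this
  linarith

/-- The mean of a monotone function over the random subsets of cardinality `r` increases with
`r`. -/
lemma levelSum_mul_le_of_le (hx : ∀ i ∈ s, 0 ≤ x i) (hy : ∀ i ∈ s, 0 ≤ y i)
    (h : ∀ R ⊆ s, ∀ a ∈ s, a ∉ R → φ R ≤ φ (insert a R)) {i j : ℤ} (hij : i ≤ j) :
    levelSum s x y i φ * levelSum s x y j (fun _ => 1) ≤
      levelSum s x y i (fun _ => 1) * levelSum s x y j φ := by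
  induction j, hij using Int.leInduction with
  | base => exact (mul_comm _ _).le
  | succ j hij ih =>
    have hs := levelSum_mul_succ_le (r := j) hx hy h
    have hlc := isLogConcave_levelSum hx hy i (j + 1) j (i + 1) hij (by omega) (by omega)
    have ni := levelSum_one_nonneg (r := i) hx hy
    have nj := levelSum_one_nonneg (r := j) hx hy
    have nj' := levelSum_one_nonneg (r := j + 1) hx hy
    simp only at hlc
    rcases nj.eq_or_lt with h0 | h0
    · rw [← h0, zero_mul] at hlc
      rcases mul_eq_zero.1 (le_antisymm hlc (mul_nonneg ni nj')) with h1 | h1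
      · rw [h1, levelSum_eq_zero hx hy h1]
        simp
      · rw [h1, levelSum_eq_zero hx hy h1]
        simp
    · refine le_of_mul_le_mul_right ?_ h0
      have k1 := mul_le_mul_of_nonneg_right ih nj'
      have k2 := mul_le_mul_of_nonneg_left hs ni
      linarith

end SubsetSum

/-! ### Correlation inequalities for finite sequences -/

/-- Chebyshev's sum inequality for an antitone `f` and a sequence of ratios `n / p` that is
increasing on the support of `p`. -/
lemma sum_mul_sum_le_of_antitone {I : Finset ℤ} {f p n : ℤ → ℝ} (hf : Antitone f)
    (h : ∀ i j, i ≤ j → n i * p j ≤ p i * n j) :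
    (∑ i ∈ I, f i * n i) * ∑ j ∈ I, p j ≤ (∑ i ∈ I, f i * p i) * ∑ j ∈ I, n j := by
  have h1 : (∑ i ∈ I, f i * p i) * ∑ j ∈ I, n j - (∑ i ∈ I, f i * n i) * ∑ j ∈ I, p j =
      ∑ i ∈ I, ∑ j ∈ I, f i * (p i * n j - n i * p j) := by
    rw [Finset.sum_mul_sum, Finset.sum_mul_sum, ← Finset.sum_sub_distrib]
    refine Finset.sum_congr rfl fun i _ => ?_
    rw [← Finset.sum_sub_distrib]
    exact Finset.sum_congr rfl fun j _ => by ring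
  -- Symmetrizing in `i` and `j` makes each term a product of two differences of matching sign.
  have h2 : ∑ i ∈ I, ∑ j ∈ I, f i * (p i * n j - n i * p j) =
      ∑ i ∈ I, ∑ j ∈ I, f j * (p j * n i - n j * p i) := Finset.sum_comm
  have h3 : 0 ≤ ∑ i ∈ I, ∑ j ∈ I, f i * (p i * n j - n i * p j) +
      ∑ i ∈ I, ∑ j ∈ I, f j * (p j * n i - n j * p i) := by
    rw [← Finset.sum_add_distrib]
    refine Finset.sum_nonneg fun i _ => ?_
    rw [← Finset.sum_add_distrib]
    refine Finset.sum_nonneg fun j _ => ?_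
    have h4 : f i * (p i * n j - n i * p j) + f j * (p j * n i - n j * p i) =
        (f i - f j) * (p i * n j - n i * p j) := by ring
    rw [h4]
    rcases le_total i j with hij | hij
    · exact mul_nonneg (sub_nonneg.2 (hf hij)) (sub_nonneg.2 (h i j hij))
    · have := h j i hij
      exact mul_nonneg_of_nonpos_of_nonpos (sub_nonpos.2 (hf hij)) (by linarith)
  linarith

/-- The chain of bounds `n i / p i ≤ k (i - 1) / p (i - 1)`, together with log-concavity of `p`,
bounds `n (r + 1) / p (r + 1)` by `k 0 / p 0` and the increments `k i - n i`. -/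
lemma mul_le_of_logConcave_chain {p n k : ℕ → ℝ} (hp : ∀ i, 0 ≤ p i)
    (hlc : ∀ i j, p 0 * p (i + j) ≤ p i * p j)
    (hs : ∀ i, n (i + 1) * p i ≤ p (i + 1) * k i)
    (hz : ∀ i, p i = 0 → n i = 0 ∧ k i = 0) (hnk : ∀ i, n i ≤ k i) (r : ℕ) :
    p 0 * n (r + 1) ≤
      p (r + 1) * k 0 + ∑ i ∈ Finset.range r, p (r - i) * (k (i + 1) - n (i + 1)) := by
  have hrest : 0 ≤ ∑ i ∈ Finset.range r, p (r - i) * (k (i + 1) - n (i + 1)) :=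
    Finset.sum_nonneg fun i _ => mul_nonneg (hp _) (sub_nonneg.2 (hnk _))
  rcases (hp 0).eq_or_lt with h0 | h0
  · rw [(hz 0 h0.symm).2, ← h0]
    linarith
  rcases (hp (r + 1)).eq_or_lt with h1 | h1
  · rw [(hz _ h1.symm).1, ← h1]
    linarith
  -- There are no internal zeros: `p 0 * p (r + 1) ≤ p i * p (r + 1 - i)`.
  have hpos : ∀ i, i ≤ r + 1 → 0 < p i := by
    intro i hi
    refine (hp i).lt_of_ne' fun h => ?_
    have := hlc i (r + 1 - i)
    rw [Nat.add_sub_cancel' hi, h, zero_mul] at this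
    exact absurd this (not_le.2 (mul_pos h0 h1))
  have hstep : ∀ i, i + 1 ≤ r + 1 → n (i + 1) / p (i + 1) ≤ k i / p i := by
    intro i hi
    rw [div_le_div_iff₀ (hpos _ hi) (hpos _ (by omega))]
    have := hs i
    linarith
  -- Each step bounds `n (q + 1) / p (q + 1)` by `k q / p q`, which is `n q / p q` plus the
  -- increment `(k q - n q) / p q`.
  have hchain : ∀ q, q ≤ r → n (q + 1) / p (q + 1) ≤
      k 0 / p 0 + ∑ i ∈ Finset.range q, (k (i + 1) - n (i + 1)) / p (i + 1) := by
    intro q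
    induction q with
    | zero =>
      intro _
      simpa using hstep 0 (by omega)
    | succ q ih =>
      intro hq
      rw [Finset.sum_range_succ, sub_div]
      have := ih (by omega)
      have := hstep (q + 1) (by omega)
      linarith
  have h2 := mul_le_mul_of_nonneg_left (hchain r le_rfl) (mul_pos h0 h1).le
  have h3 : p 0 * p (r + 1) * (n (r + 1) / p (r + 1)) = p 0 * n (r + 1) := by field_simp
  have h4 : p 0 * p (r + 1) * (k 0 / p 0) = p (r + 1) * k 0 := by field_simp
  rw [h3, mul_add, h4, Finset.mul_sum] at h2
  refine h2.trans (add_le_add_right (Finset.sum_le_sum fun i hi => ?_) _)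
  have hir : i < r := Finset.mem_range.1 hi
  have hpi := hpos (i + 1) (by omega)
  have h5 := hlc (i + 1) (r - i)
  rw [show i + 1 + (r - i) = r + 1 by omega] at h5
  rw [← mul_div_assoc, div_le_iff₀ hpi]
  have := mul_le_mul_of_nonneg_right h5 (sub_nonneg.2 (hnk (i + 1)))
  linarith

/-- The chain bound is summed over `r`. After exchanging the sums, `k (i + 1) - n (i + 1)` has
coefficient `p 1 + ... + p (N - 1 - i)`, at most the whole mass on this side of the excluded point.
-/
lemma mul_sum_le_of_logConcave {p n k : ℕ → ℝ} (hp : ∀ i, 0 ≤ p i)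
    (hlc : ∀ i j, p 0 * p (i + j) ≤ p i * p j)
    (hs : ∀ i, n (i + 1) * p i ≤ p (i + 1) * k i)
    (hz : ∀ i, p i = 0 → n i = 0 ∧ k i = 0) (hnk : ∀ i, n i ≤ k i) (N : ℕ) :
    p 0 * ∑ i ∈ Finset.range N, n (i + 1) ≤ (∑ i ∈ Finset.range N, p (i + 1)) *
      (k 0 + (∑ i ∈ Finset.range N, k (i + 1) - ∑ i ∈ Finset.range N, n (i + 1))) := by
  rw [← Finset.sum_sub_distrib, mul_add, Finset.sum_mul, Finset.mul_sum]
  refine (Finset.sum_le_sum fun r _ => mul_le_of_logConcave_chain hp hlc hs hz hnk r).trans ?_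
  rw [Finset.sum_add_distrib]
  refine add_le_add_right ?_ _
  rw [Finset.sum_comm' (t' := Finset.range N) (s' := fun i => Finset.Ico (i + 1) N)
    (by intro a b; simp only [Finset.mem_range, Finset.mem_Ico]; omega), Finset.mul_sum]
  refine Finset.sum_le_sum fun i _ => ?_
  rw [← Finset.sum_mul]
  refine mul_le_mul_of_nonneg_right ?_ (sub_nonneg.2 (hnk _))
  rw [Finset.sum_Ico_eq_sum_range]
  calc ∑ j ∈ Finset.range (N - (i + 1)), p (i + 1 + j - i)
      = ∑ j ∈ Finset.range (N - (i + 1)), p (j + 1) :=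
        Finset.sum_congr rfl fun j _ => by congr 1; omega
    _ ≤ ∑ j ∈ Finset.range N, p (j + 1) :=
        Finset.sum_le_sum_of_subset_of_nonneg (by intro j; simp only [Finset.mem_range]; omega)
          fun j _ _ => hp _

lemma sum_Icc_sub_add (f : ℤ → ℝ) (d : ℤ) (N : ℕ) : ∑ r ∈ Finset.Icc (d - N) (d + N), f r =
    f d + ∑ j ∈ Finset.range N, f (d + ((j + 1 : ℕ) : ℤ)) +
      ∑ j ∈ Finset.range N, f (d - ((j + 1 : ℕ) : ℤ)) := by
  induction N with
  | zero => simp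
  | succ N ih =>
    have h : Finset.Icc (d - ((N + 1 : ℕ) : ℤ)) (d + ((N + 1 : ℕ) : ℤ)) =
        insert (d - ((N + 1 : ℕ) : ℤ)) (insert (d + ((N + 1 : ℕ) : ℤ))
          (Finset.Icc (d - N) (d + N))) := by
      ext r
      simp only [Finset.mem_insert, Finset.mem_Icc]
      push_cast
      omega
    rw [h, Finset.sum_insert, Finset.sum_insert, ih, Finset.sum_range_succ, Finset.sum_range_succ]
    · ring
    · simp only [Finset.mem_Icc]
      push_cast
      omega
    · simp only [Finset.mem_insert, Finset.mem_Icc]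
      push_cast
      omega

/-- A log-concave law `p` on `ℤ` can be coupled with its conditioning on `r ≠ d` so that the two
differ by at most one; this is the resulting inequality for means. -/
lemma sum_ne_mul_sum_le {p n k : ℤ → ℝ} (hp : ∀ i, 0 ≤ p i) (hlc : IsLogConcave p)
    (hs : ∀ i, n (i + 1) * p i ≤ p (i + 1) * k i) (hs' : ∀ i, n i * p (i + 1) ≤ p i * k (i + 1))
    (hz : ∀ i, p i = 0 → n i = 0 ∧ k i = 0) (hnk : ∀ i, n i ≤ k i) (d : ℤ) (N : ℕ) :
    (∑ r ∈ Finset.Icc (d - N) (d + N), (if r ≠ d then 1 else 0) * n r) *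
        ∑ r ∈ Finset.Icc (d - N) (d + N), p r ≤
      (∑ r ∈ Finset.Icc (d - N) (d + N), (if r ≠ d then 1 else 0) * p r) *
        ∑ r ∈ Finset.Icc (d - N) (d + N), k r := by
  have hu := mul_sum_le_of_logConcave (p := fun i : ℕ => p (d + (i : ℤ)))
    (n := fun i : ℕ => n (d + (i : ℤ))) (k := fun i : ℕ => k (d + (i : ℤ))) (fun i => hp _)
    (fun i j => hlc _ _ _ _ (by push_cast; omega) (by push_cast; omega) (by push_cast; omega))
    (fun i => by
      have := hs (d + i)
      rw [add_assoc] at this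
      exact_mod_cast this)
    (fun i => hz _) (fun i => hnk _) N
  -- The same bound run downwards from `d`, with the steps supplied by `hs'`.
  have hl := mul_sum_le_of_logConcave (p := fun i : ℕ => p (d - (i : ℤ)))
    (n := fun i : ℕ => n (d - (i : ℤ))) (k := fun i : ℕ => k (d - (i : ℤ))) (fun i => hp _)
    (fun i j => by
      have := hlc (d - (i + j : ℕ)) d (d - (i : ℤ)) (d - (j : ℤ)) (by push_cast; omega)
        (by omega) (by push_cast; omega)
      simp only [Nat.cast_zero, sub_zero]
      linarith)
    (fun i => by
      have := hs' (d - ((i + 1 : ℕ) : ℤ))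
      rw [show d - ((i + 1 : ℕ) : ℤ) + 1 = d - i by push_cast; ring] at this
      exact this)
    (fun i => hz _) (fun i => hnk _) N
  have hne : ∀ f : ℤ → ℝ,
      ∑ r ∈ Finset.Icc (d - N) (d + N), (if r ≠ d then 1 else 0) * f r =
        ∑ j ∈ Finset.range N, f (d + ((j + 1 : ℕ) : ℤ)) +
          ∑ j ∈ Finset.range N, f (d - ((j + 1 : ℕ) : ℤ)) := by
    intro f
    rw [sum_Icc_sub_add]
    have h1 : ∀ j : ℕ, d + ((j + 1 : ℕ) : ℤ) ≠ d := fun j => by push_cast; omega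
    have h2 : ∀ j : ℕ, d - ((j + 1 : ℕ) : ℤ) ≠ d := fun j => by push_cast; omega
    simp only [h1, h2, ne_eq, not_true_eq_false, not_false_eq_true, if_true, if_false, zero_mul,
      one_mul, zero_add]
  rw [hne, hne, sum_Icc_sub_add, sum_Icc_sub_add]
  simp only [Nat.cast_zero, add_zero, sub_zero] at hu hl
  have ku : ∑ j ∈ Finset.range N, n (d + ((j + 1 : ℕ) : ℤ)) ≤
    ∑ j ∈ Finset.range N, k (d + ((j + 1 : ℕ) : ℤ)) := Finset.sum_le_sum fun _ _ => hnk _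
  have kl : ∑ j ∈ Finset.range N, n (d - ((j + 1 : ℕ) : ℤ)) ≤
    ∑ j ∈ Finset.range N, k (d - ((j + 1 : ℕ) : ℤ)) := Finset.sum_le_sum fun _ _ => hnk _
  have pu : 0 ≤ ∑ j ∈ Finset.range N, p (d + ((j + 1 : ℕ) : ℤ)) :=
    Finset.sum_nonneg fun _ _ => hp _
  have pl : 0 ≤ ∑ j ∈ Finset.range N, p (d - ((j + 1 : ℕ) : ℤ)) :=
    Finset.sum_nonneg fun _ _ => hp _
  -- The terms pairing the two sides of `d` need only `n ≤ k`.
  have c1 := mul_nonneg pu (sub_nonneg.2 kl)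
  have c2 := mul_nonneg pl (sub_nonneg.2 ku)
  linarith

/-! ### Correlation inequalities for random subsets -/

section SubsetSum

variable {ι : Type*} [DecidableEq ι] {s : Finset ι} {x y : ι → ℝ} {φ ψ : Finset ι → ℝ}

/-- The radius includes `|d|`, so that a window centred at `d` reaches every cardinality from `0` to
that of `s`. -/
lemma card_mem_Icc_of_subset {ι : Type*} {s R : Finset ι} (hR : R ⊆ s) (d : ℤ) :
    (R.card : ℤ) ∈ Finset.Icc (d - ((s.card + d.natAbs : ℕ) : ℤ))
      (d + ((s.card + d.natAbs : ℕ) : ℤ)) := by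
  have := Finset.card_le_card hR
  rw [Finset.mem_Icc]
  constructor <;> omega

lemma subsetSum_mul_le_of_antitone (hx : ∀ i ∈ s, 0 ≤ x i) (hy : ∀ i ∈ s, 0 ≤ y i) {a f : ℤ → ℝ}
    (ha : ∀ i, 0 ≤ a i) (hf : Antitone f)
    (h : ∀ R ⊆ s, ∀ b ∈ s, b ∉ R → φ R ≤ φ (insert b R)) :
    subsetSum s x y (fun R => a R.card * (f R.card * φ R)) *
        subsetSum s x y (fun R => a R.card * 1) ≤
      subsetSum s x y (fun R => a R.card * f R.card) *
        subsetSum s x y (fun R => a R.card * φ R) := by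
  have hI : ∀ R ⊆ s, (R.card : ℤ) ∈ Finset.Icc (0 - ((s.card + (0 : ℤ).natAbs : ℕ) : ℤ))
      (0 + ((s.card + (0 : ℤ).natAbs : ℕ) : ℤ)) := fun R hR => card_mem_Icc_of_subset hR 0
  have e1 : subsetSum s x y (fun R => a R.card * (f R.card * φ R)) =
      subsetSum s x y (fun R => (f R.card * a R.card) * φ R) :=
    subsetSum_congr fun R _ => by ring
  have e2 : subsetSum s x y (fun R => a R.card * f R.card) =
      subsetSum s x y (fun R => (f R.card * a R.card) * 1) :=
    subsetSum_congr fun R _ => by ring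
  rw [e1, e2, subsetSum_eq_sum_levelSum hI (fun r => f r * a r) (φ := φ),
    subsetSum_eq_sum_levelSum hI (fun r => f r * a r) (φ := fun _ => 1),
    subsetSum_eq_sum_levelSum hI a (φ := φ), subsetSum_eq_sum_levelSum hI a (φ := fun _ => 1)]
  simp only [mul_assoc]
  refine sum_mul_sum_le_of_antitone hf fun i j hij => ?_
  have := mul_le_mul_of_nonneg_left (levelSum_mul_le_of_le hx hy h hij) (mul_nonneg (ha i) (ha j))
  linarith

/-- Grouped by cardinality, this is the inequality for log-concave laws on `ℤ`: `hup` and `hdown`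
transfer means between neighbouring levels in either direction. -/
lemma subsetSum_ne_mul_le (hx : ∀ i ∈ s, 0 ≤ x i) (hy : ∀ i ∈ s, 0 ≤ y i) {a : ℤ → ℝ}
    (ha : ∀ i, 0 ≤ a i) (hlc : IsLogConcave a) (hle : ∀ R ⊆ s, φ R ≤ ψ R)
    (hup : ∀ R ⊆ s, ∀ b ∈ s, b ∉ R → φ (insert b R) ≤ ψ R)
    (hdown : ∀ R ⊆ s, ∀ b ∈ s, b ∉ R → φ R ≤ ψ (insert b R)) (d : ℤ) :
    subsetSum s x y (fun R => a R.card * ((if (R.card : ℤ) ≠ d then 1 else 0) * φ R)) *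
        subsetSum s x y (fun R => a R.card * 1) ≤
      subsetSum s x y (fun R => a R.card * (if (R.card : ℤ) ≠ d then 1 else 0)) *
        subsetSum s x y (fun R => a R.card * ψ R) := by
  have hI : ∀ R ⊆ s, (R.card : ℤ) ∈ _ := fun R hR => card_mem_Icc_of_subset hR d
  have e1 : subsetSum s x y (fun R => a R.card * ((if (R.card : ℤ) ≠ d then 1 else 0) * φ R)) =
      subsetSum s x y (fun R => ((if (R.card : ℤ) ≠ d then 1 else 0) * a R.card) * φ R) :=
    subsetSum_congr fun R _ => by ring
  have e2 : subsetSum s x y (fun R => a R.card * (if (R.card : ℤ) ≠ d then 1 else 0)) =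
      subsetSum s x y (fun R => ((if (R.card : ℤ) ≠ d then 1 else 0) * a R.card) * 1) :=
    subsetSum_congr fun R _ => by ring
  rw [e1, e2, subsetSum_eq_sum_levelSum hI (fun r => (if r ≠ d then 1 else 0) * a r) (φ := φ),
    subsetSum_eq_sum_levelSum hI (fun r => (if r ≠ d then 1 else 0) * a r) (φ := fun _ => 1),
    subsetSum_eq_sum_levelSum hI a (φ := ψ), subsetSum_eq_sum_levelSum hI a (φ := fun _ => 1)]
  simp only [mul_assoc]
  refine sum_ne_mul_sum_le (p := fun r => a r * levelSum s x y r fun _ => 1)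
    (n := fun r => a r * levelSum s x y r φ) (k := fun r => a r * levelSum s x y r ψ)
    (fun i => mul_nonneg (ha i) (levelSum_one_nonneg hx hy))
    (hlc.mul (isLogConcave_levelSum hx hy) ha fun i => levelSum_one_nonneg hx hy)
    (fun i => ?_) (fun i => ?_) (fun i hi => ?_)
    (fun i => mul_le_mul_of_nonneg_left (levelSum_mono hx hy hle) (ha i)) d _
  · have := mul_le_mul_of_nonneg_left (levelSum_succ_mul_le (r := i) hx hy hup)
      (mul_nonneg (ha i) (ha (i + 1)))
    linarith
  · have := mul_le_mul_of_nonneg_left (levelSum_mul_succ_le (r := i) hx hy hdown)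
      (mul_nonneg (ha i) (ha (i + 1)))
    linarith
  · rcases mul_eq_zero.1 hi with h | h
    · simp [h]
    · simp [levelSum_eq_zero hx hy h]

end SubsetSum

/-! ### Laws of count vectors that split along a color -/

/-- The count vector when the balls in `R` have the colors `loc` and all the other ones of `T`
balls have color `α`. -/
def splitCount {m : ℕ} {ι : Type*} (T : ℤ) (loc : ι → Fin m) (α : Fin m) (R : Finset ι)
    (β : Fin m) : ℤ :=
  if β = α then T - R.card else ((R.filter fun i => loc i = β).card : ℤ)

/-- The count vector `M` under the law `π` is distributed as `splitCount`, where `loc` is drawn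
according to `ρ` and, independently, `R` is drawn with a weight that is the product of Bernoulli
weights and a log-concave function of the cardinality. -/
structure ColorSplit {m : ℕ} {A : Type*} [Fintype A] (π : A → ℝ) (M : A → Fin m → ℤ)
    (α : Fin m) where
  ι : Type
  decEq : DecidableEq ι
  s : Finset ι
  x : ι → ℝ
  y : ι → ℝ
  a : ℤ → ℝ
  T : ℤ
  ζ : Type
  Z : Finset ζ
  ρ : ζ → ℝ
  loc : ζ → ι → Fin m
  x_nonneg : ∀ i ∈ s, 0 ≤ x i
  y_nonneg : ∀ i ∈ s, 0 ≤ y i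
  a_nonneg : ∀ i, 0 ≤ a i
  a_logConcave : IsLogConcave a
  ρ_nonneg : ∀ z ∈ Z, 0 ≤ ρ z
  expect : ∀ Φ : (Fin m → ℤ) → ℝ, ∑ b, π b * Φ (M b) =
    ∑ z ∈ Z, ρ z * subsetSum s x y fun R => a R.card * Φ (splitCount T (loc z) α R)

namespace ColorSplit

variable {m : ℕ} {A : Type*} [Fintype A] {π : A → ℝ} {M : A → Fin m → ℤ} {α : Fin m}

lemma splitCount_self {ι : Type*} (T : ℤ) (loc : ι → Fin m) (R : Finset ι) :
    splitCount T loc α R α = T - R.card := if_pos rfl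

lemma splitCount_mono {ι : Type*} (T : ℤ) (loc : ι → Fin m) {R R' : Finset ι} (h : R ⊆ R')
    {β : Fin m} (hβ : β ≠ α) : splitCount T loc α R β ≤ splitCount T loc α R' β := by
  rw [splitCount, splitCount, if_neg hβ, if_neg hβ]
  exact_mod_cast Finset.card_le_card (Finset.filter_subset_filter _ h)

lemma splitCount_insert_of_ne {ι : Type*} [DecidableEq ι] (T : ℤ) (loc : ι → Fin m)
    (R : Finset ι) (b : ι) {β : Fin m} (hβ : β ≠ α) (hb : β ≠ loc b) :
    splitCount T loc α (insert b R) β = splitCount T loc α R β := by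
  rw [splitCount, splitCount, if_neg hβ, if_neg hβ, Finset.filter_insert, if_neg (Ne.symm hb)]

/-- The law of the count of color `α`. -/
lemma expect_coord (S : ColorSplit π M α) (f : ℤ → ℝ) :
    letI := S.decEq
    ∑ b, π b * f (M b α) = (∑ z ∈ S.Z, S.ρ z) *
      subsetSum S.s S.x S.y fun R => S.a R.card * f (S.T - R.card) := by
  let := S.decEq
  have h := S.expect fun v => f (v α)
  simp only [splitCount_self] at h
  rw [h, Finset.sum_mul]

/-- As `loc` is independent of `R` and `f` sees only `|R|`, the mean of `f` is the same for every
`z`; the inequality can be proved for fixed locations and averaged. -/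
lemma sum_mul_le_of_forall (S : ColorSplit π M α) (hπ : ∑ b, π b = 1) {f : ℤ → ℝ}
    {Φ Ψ : (Fin m → ℤ) → ℝ}
    (h : letI := S.decEq
      ∀ z ∈ S.Z, subsetSum S.s S.x S.y (fun R => S.a R.card *
          (f (S.T - R.card) * Φ (splitCount S.T (S.loc z) α R))) *
          subsetSum S.s S.x S.y (fun R => S.a R.card * 1) ≤
        subsetSum S.s S.x S.y (fun R => S.a R.card * f (S.T - R.card)) *
          subsetSum S.s S.x S.y (fun R => S.a R.card * Ψ (splitCount S.T (S.loc z) α R))) :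
    ∑ b, π b * (f (M b α) * Φ (M b)) ≤ (∑ b, π b * f (M b α)) * ∑ b, π b * Ψ (M b) := by
  let := S.decEq
  have h1 := S.expect_coord fun _ => 1
  simp only [mul_one, hπ] at h1
  have h2 := S.expect fun v => f (v α) * Φ v
  simp only [splitCount_self] at h2
  have hρ : 0 ≤ ∑ z ∈ S.Z, S.ρ z := Finset.sum_nonneg S.ρ_nonneg
  rw [S.expect_coord f, S.expect Ψ, h2]
  simp only [mul_one] at h
  generalize (∑ z ∈ S.Z, S.ρ z) = r at *
  -- Neither factor of the law is normalized separately; `h1` says that their total masses multiply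
  -- to `1`.
  calc ∑ z ∈ S.Z, S.ρ z * subsetSum S.s S.x S.y (fun R => S.a R.card *
          (f (S.T - R.card) * Φ (splitCount S.T (S.loc z) α R)))
      = r * ∑ z ∈ S.Z, S.ρ z * (subsetSum S.s S.x S.y (fun R => S.a R.card *
          (f (S.T - R.card) * Φ (splitCount S.T (S.loc z) α R))) *
          subsetSum S.s S.x S.y (fun R => S.a R.card)) := by
        simp only [← mul_assoc]
        rw [← Finset.sum_mul, mul_comm, mul_assoc, mul_comm _ r, ← h1, mul_one]
    _ ≤ r * ∑ z ∈ S.Z, S.ρ z *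
        (subsetSum S.s S.x S.y (fun R => S.a R.card * f (S.T - R.card)) *
          subsetSum S.s S.x S.y
            (fun R => S.a R.card * Ψ (splitCount S.T (S.loc z) α R))) :=
        mul_le_mul_of_nonneg_left (Finset.sum_le_sum fun z hz =>
          mul_le_mul_of_nonneg_left (h z hz) (S.ρ_nonneg z hz)) hρ
    _ = _ := by
        rw [mul_assoc]
        congr 1
        rw [Finset.mul_sum]
        exact Finset.sum_congr rfl fun z _ => by ring

/-- One count is negatively associated with the other counts. -/
theorem sum_mul_le_of_monotone (S : ColorSplit π M α) (hπ : ∑ b, π b = 1) {f : ℤ → ℝ}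
    (hf : Monotone f) {Φ : (Fin m → ℤ) → ℝ}
    (hΦ : ∀ v v', (∀ β, β ≠ α → v β ≤ v' β) → Φ v ≤ Φ v') :
    ∑ b, π b * (f (M b α) * Φ (M b)) ≤ (∑ b, π b * f (M b α)) * ∑ b, π b * Φ (M b) := by
  let := S.decEq
  refine S.sum_mul_le_of_forall hπ fun z _ => ?_
  -- The count of `α` is `T - |R|`, so a monotone `f` becomes antitone in `|R|`.
  exact subsetSum_mul_le_of_antitone (f := fun r => f (S.T - r)) S.x_nonneg S.y_nonneg S.a_nonneg
    (fun i j hij => hf (by omega))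
    fun R _ b _ _ => hΦ _ _ fun β hβ => splitCount_mono _ _ (Finset.subset_insert b R) hβ

/-- Conditioning on a count being different from `d` amounts to changing at most one other
count. -/
theorem sum_ne_mul_le (S : ColorSplit π M α) (hπ : ∑ b, π b = 1) (d : ℤ)
    {Φ Ψ : (Fin m → ℤ) → ℝ}
    (hΦ : ∀ v v' γ, (∀ β, β ≠ α → β ≠ γ → v β = v' β) → Φ v ≤ Ψ v') :
    ∑ b, π b * ((if M b α ≠ d then 1 else 0) * Φ (M b)) ≤
      (∑ b, π b * (if M b α ≠ d then 1 else 0)) * ∑ b, π b * Ψ (M b) := by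
  let := S.decEq
  refine S.sum_mul_le_of_forall hπ (f := fun r => if r ≠ d then 1 else 0) fun z _ => ?_
  have hd : ∀ r : ℤ, S.T - r ≠ d ↔ r ≠ S.T - d := fun r => by omega
  simp only [hd]
  exact subsetSum_ne_mul_le S.x_nonneg S.y_nonneg S.a_nonneg S.a_logConcave
    (fun R _ => hΦ _ _ α fun _ _ _ => rfl)
    (fun R _ b _ _ => hΦ _ _ (S.loc z b) fun β hβ hb => splitCount_insert_of_ne _ _ R b hβ hb)
    (fun R _ b _ _ => hΦ _ _ (S.loc z b) fun β hβ hb =>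
      (splitCount_insert_of_ne _ _ R b hβ hb).symm) _

end ColorSplit

/-! ### Size bias inequalities -/

section SizeBias

variable {m : ℕ} {A : Type*} [Fintype A] {π : A → ℝ} {M : A → Fin m → ℤ} {w : Fin m → ℝ}

lemma le_maxWeight (w : Fin m → ℝ) (α : Fin m) : w α ≤ maxWeight w :=
  le_ciSup (Set.finite_range w).bddAbove α

/-- The weighted number of coordinates `α` for which `p α` holds. -/
def weightedCount (w : Fin m → ℝ) (p : Fin m → ℤ → Prop) [∀ α, DecidablePred (p α)]
    (v : Fin m → ℤ) : ℝ :=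
  ∑ α, w α * (if p α (v α) then 1 else 0)

variable {p : Fin m → ℤ → Prop} [∀ α, DecidablePred (p α)]

lemma sum_mul_weightedCount_mul (F : (Fin m → ℤ) → ℝ) :
    ∑ b, π b * (weightedCount w p (M b) * F (M b)) =
      ∑ α, w α * ∑ b, π b * ((if p α (M b α) then 1 else 0) * F (M b)) := by
  simp only [weightedCount, Finset.mul_sum, Finset.sum_mul]
  rw [Finset.sum_comm]
  exact Finset.sum_congr rfl fun α _ => Finset.sum_congr rfl fun b _ => by ring

/-- Bounds on the moment generating function of a weighted count, from bounds for each single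
indicator. -/
theorem sum_exp_weightedCount_le (hw : ∀ α, 0 ≤ w α) (hπ : ∑ b, π b = 1) {μ c : ℝ} (hc : 0 < c)
    (hμ : ∑ b, π b * weightedCount w p (M b) = μ)
    (hpos : ∀ α, ∀ θ : ℝ, 0 ≤ θ →
      ∑ b, π b * ((if p α (M b α) then 1 else 0) * Real.exp (θ * weightedCount w p (M b))) ≤
        (∑ b, π b * (if p α (M b α) then 1 else 0)) *
          (Real.exp (θ * c) * ∑ b, π b * Real.exp (θ * weightedCount w p (M b))))
    (hneg : ∀ α, ∀ θ : ℝ, θ ≤ 0 →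
      (∑ b, π b * (if p α (M b α) then 1 else 0)) *
          (Real.exp (θ * c) * ∑ b, π b * Real.exp (θ * weightedCount w p (M b))) ≤
        ∑ b, π b * ((if p α (M b α) then 1 else 0) * Real.exp (θ * weightedCount w p (M b))))
    (θ : ℝ) :
    ∑ b, π b * Real.exp (θ * weightedCount w p (M b)) ≤
      Real.exp (μ / c * (Real.exp (c * θ) - 1)) := by
  have hμ' : μ = ∑ α, w α * ∑ b, π b * (if p α (M b α) then 1 else 0) := by
    have := sum_mul_weightedCount_mul (π := π) (M := M) (w := w) (p := p) fun _ => 1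
    simpa [hμ] using this
  refine sum_exp_le_of_sizeBias hc hπ (fun θ hθ => ?_) (fun θ hθ => ?_) θ
  · rw [sum_mul_weightedCount_mul (fun v => Real.exp (θ * weightedCount w p v)), hμ',
      Finset.sum_mul]
    refine Finset.sum_le_sum fun α _ => ?_
    rw [mul_assoc]
    exact mul_le_mul_of_nonneg_left (hpos α θ hθ) (hw α)
  · rw [sum_mul_weightedCount_mul (fun v => Real.exp (θ * weightedCount w p v)), hμ',
      Finset.sum_mul]
    refine Finset.sum_le_sum fun α _ => ?_
    rw [mul_assoc]
    exact mul_le_mul_of_nonneg_left (hneg α θ hθ) (hw α)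

/-- On the event for `α`, `Y` is `w α` plus a monotone function of the other counts. The first part
factors out as `exp (θ * w α)`, the second is negatively associated with the event, and restoring
the term of `α` goes the right way for either sign of `θ`. -/
theorem sum_exp_weightedCount_ge_le (hw : ∀ α, 0 ≤ w α) (hπ0 : ∀ b, 0 ≤ π b)
    (hπ : ∑ b, π b = 1) (S : ∀ α, ColorSplit π M α) (d : Fin m → ℤ) {μ : ℝ}
    (hc : 0 < maxWeight w)
    (hμ : ∑ b, π b * weightedCount w (fun α k => d α ≤ k) (M b) = μ) (θ : ℝ) :
    ∑ b, π b * Real.exp (θ * weightedCount w (fun α k => d α ≤ k) (M b)) ≤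
      Real.exp (μ / maxWeight w * (Real.exp (maxWeight w * θ) - 1)) := by
  set Y := weightedCount w fun α k => d α ≤ k with hY
  set Yo : Fin m → (Fin m → ℤ) → ℝ := fun α v =>
    ∑ β ∈ Finset.univ.erase α, w β * (if d β ≤ v β then 1 else 0) with hYo
  have hsplit : ∀ α v, Y v = w α * (if d α ≤ v α then 1 else 0) + Yo α v := fun α v =>
    (Finset.add_sum_erase Finset.univ (fun β => w β * (if d β ≤ v β then 1 else 0))
      (Finset.mem_univ α)).symm
  have hYo_le : ∀ α v, Yo α v ≤ Y v := by
    intro α v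
    rw [hsplit α v]
    have : 0 ≤ w α * (if d α ≤ v α then 1 else 0) :=
      mul_nonneg (hw α) (by split_ifs <;> norm_num)
    linarith
  have hYo_mono : ∀ α v v', (∀ β, β ≠ α → v β ≤ v' β) → Yo α v ≤ Yo α v' := by
    intro α v v' h
    refine Finset.sum_le_sum fun β hβ => mul_le_mul_of_nonneg_left ?_ (hw β)
    have := h β (Finset.ne_of_mem_erase hβ)
    split_ifs
    · rfl
    · omega
    · norm_num
    · rfl
  have hf : ∀ α, Monotone fun k : ℤ => if d α ≤ k then (1 : ℝ) else 0 := by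
    intro α i j hij
    dsimp only
    split_ifs
    · rfl
    · omega
    · norm_num
    · rfl
  have hprob : ∀ α, 0 ≤ ∑ b, π b * (if d α ≤ M b α then (1 : ℝ) else 0) := fun α =>
    Finset.sum_nonneg fun b _ => mul_nonneg (hπ0 b) (by split_ifs <;> norm_num)
  have hfac : ∀ α (θ : ℝ), ∑ b, π b * ((if d α ≤ M b α then 1 else 0) * Real.exp (θ * Y (M b))) =
      Real.exp (θ * w α) *
        ∑ b, π b * ((if d α ≤ M b α then 1 else 0) * Real.exp (θ * Yo α (M b))) := by
    intro α θ
    rw [Finset.mul_sum]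
    refine Finset.sum_congr rfl fun b _ => ?_
    split_ifs with h
    · rw [hsplit α (M b), if_pos h, mul_add, Real.exp_add]
      ring_nf
    · simp
  refine sum_exp_weightedCount_le hw hπ hc hμ (fun α θ hθ => ?_) (fun α θ hθ => ?_) θ
  · rw [hfac]
    have h1 := (S α).sum_mul_le_of_monotone hπ (hf α) (Φ := fun v => Real.exp (θ * Yo α v))
      fun v v' h => Real.exp_le_exp.2 (mul_le_mul_of_nonneg_left (hYo_mono α v v' h) hθ)
    have h2 : ∑ b, π b * Real.exp (θ * Yo α (M b)) ≤ ∑ b, π b * Real.exp (θ * Y (M b)) :=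
      Finset.sum_le_sum fun b _ => mul_le_mul_of_nonneg_left
        (Real.exp_le_exp.2 (mul_le_mul_of_nonneg_left (hYo_le α _) hθ)) (hπ0 b)
    calc _ ≤ Real.exp (θ * maxWeight w) * ((∑ b, π b * (if d α ≤ M b α then (1 : ℝ) else 0)) *
          ∑ b, π b * Real.exp (θ * Y (M b))) := by
          refine mul_le_mul (Real.exp_le_exp.2
            (mul_le_mul_of_nonneg_left (le_maxWeight w α) hθ))
            (h1.trans (mul_le_mul_of_nonneg_left h2 (hprob α))) ?_ (Real.exp_pos _).le
          exact Finset.sum_nonneg fun b _ => mul_nonneg (hπ0 b)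
            (mul_nonneg (by split_ifs <;> norm_num) (Real.exp_pos _).le)
      _ = _ := by ring
  · rw [hfac]
    have h1 := (S α).sum_mul_le_of_monotone hπ (hf α) (Φ := fun v => -Real.exp (θ * Yo α v))
      fun v v' h => neg_le_neg
        (Real.exp_le_exp.2 (mul_le_mul_of_nonpos_left (hYo_mono α v v' h) hθ))
    simp only [mul_neg, Finset.sum_neg_distrib, neg_le_neg_iff] at h1
    have h2 : ∑ b, π b * Real.exp (θ * Y (M b)) ≤ ∑ b, π b * Real.exp (θ * Yo α (M b)) :=
      Finset.sum_le_sum fun b _ => mul_le_mul_of_nonneg_left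
        (Real.exp_le_exp.2 (mul_le_mul_of_nonpos_left (hYo_le α _) hθ)) (hπ0 b)
    calc _ = Real.exp (θ * maxWeight w) * ((∑ b, π b * (if d α ≤ M b α then (1 : ℝ) else 0)) *
          ∑ b, π b * Real.exp (θ * Y (M b))) := by ring
      _ ≤ _ := by
          refine mul_le_mul (Real.exp_le_exp.2
            (mul_le_mul_of_nonpos_left (le_maxWeight w α) hθ))
            ((mul_le_mul_of_nonneg_left h2 (hprob α)).trans h1) ?_ (Real.exp_pos _).le
          exact mul_nonneg (hprob α) (Finset.sum_nonneg fun b _ => mul_nonneg (hπ0 b)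
            (Real.exp_pos _).le)

/-- Source of the factor `2`: each of the two coordinates that may differ contributes at most its
weight. -/
lemma weightedCount_le_add (hw : ∀ α, 0 ≤ w α) {v v' : Fin m → ℤ} {α γ : Fin m}
    (h : ∀ β, β ≠ α → β ≠ γ → v β = v' β) :
    weightedCount w p v ≤ weightedCount w p v' + 2 * maxWeight w := by
  have h1 : weightedCount w p v - weightedCount w p v' ≤
      ∑ β, ((if β = α then w β else 0) + (if β = γ then w β else 0)) := by
    unfold weightedCount
    rw [← Finset.sum_sub_distrib]
    refine Finset.sum_le_sum fun β _ => ?_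
    rw [← mul_sub]
    by_cases hβ : β = α ∨ β = γ
    · have h2 : w β * ((if p β (v β) then (1 : ℝ) else 0) - if p β (v' β) then 1 else 0) ≤ w β :=
        mul_le_of_le_one_right (hw β) (by split_ifs <;> norm_num)
      refine h2.trans ?_
      have := hw β
      rcases hβ with hβ | hβ
      · rw [if_pos hβ]
        split_ifs <;> linarith
      · rw [if_pos hβ]
        split_ifs <;> linarith
    · push Not at hβ
      rw [h β hβ.1 hβ.2, if_neg hβ.1, if_neg hβ.2]
      simp
  rw [Finset.sum_add_distrib, Finset.sum_ite_eq' Finset.univ α, Finset.sum_ite_eq' Finset.univ γ,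
    if_pos (Finset.mem_univ _), if_pos (Finset.mem_univ _)] at h1
  linarith [le_maxWeight w α, le_maxWeight w γ]

theorem sum_exp_weightedCount_ne_le (hw : ∀ α, 0 ≤ w α)
    (hπ : ∑ b, π b = 1) (S : ∀ α, ColorSplit π M α) (d : Fin m → ℤ) {μ : ℝ}
    (hc : 0 < 2 * maxWeight w)
    (hμ : ∑ b, π b * weightedCount w (fun α k => k ≠ d α) (M b) = μ) (θ : ℝ) :
    ∑ b, π b * Real.exp (θ * weightedCount w (fun α k => k ≠ d α) (M b)) ≤
      Real.exp (μ / (2 * maxWeight w) * (Real.exp (2 * maxWeight w * θ) - 1)) := by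
  refine sum_exp_weightedCount_le hw hπ hc hμ (fun α θ hθ => ?_) (fun α θ hθ => ?_) θ
  · have h := (S α).sum_ne_mul_le hπ (d α)
      (Φ := fun v => Real.exp (θ * weightedCount w (fun α k => k ≠ d α) v))
      (Ψ := fun v => Real.exp (θ * (2 * maxWeight w)) *
        Real.exp (θ * weightedCount w (fun α k => k ≠ d α) v)) fun v v' γ h => by
        rw [← Real.exp_add, Real.exp_le_exp, ← mul_add]
        have := weightedCount_le_add (p := fun α k => k ≠ d α) hw h
        exact mul_le_mul_of_nonneg_left (by linarith) hθ
    refine h.trans (le_of_eq ?_)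
    congr 1
    rw [Finset.mul_sum]
    exact Finset.sum_congr rfl fun b _ => by ring
  · have h := (S α).sum_ne_mul_le hπ (d α)
      (Φ := fun v => -Real.exp (θ * weightedCount w (fun α k => k ≠ d α) v))
      (Ψ := fun v => -(Real.exp (θ * (2 * maxWeight w)) *
        Real.exp (θ * weightedCount w (fun α k => k ≠ d α) v))) fun v v' γ h => by
        rw [neg_le_neg_iff, ← Real.exp_add, Real.exp_le_exp, ← mul_add]
        have := weightedCount_le_add (p := fun α k => k ≠ d α) hw h
        exact mul_le_mul_of_nonpos_left (by linarith) hθ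
    simp only [mul_neg, Finset.sum_neg_distrib, neg_le_neg_iff] at h
    refine (le_of_eq ?_).trans h
    congr 1
    rw [Finset.mul_sum]
    exact Finset.sum_congr rfl fun b _ => by ring

end SizeBias

/-! ### Random variables with values in a finite type -/

section FiniteRange

variable {Ω : Type*} [MeasurableSpace Ω] {P : Measure Ω} {A : Type*}
  [Fintype A] {X : Ω → A}

lemma comp_eq_sum_indicator {Ω : Type*} {X : Ω → A} (F : A → ℝ) :
    (fun ω => F (X ω)) = fun ω => ∑ a, Set.indicator {ω | X ω = a} (fun _ => F a) ω := by
  classical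
  funext ω
  simp [Set.indicator_apply]

lemma integrable_comp_of_finite [IsProbabilityMeasure P]
    (hX : ∀ a, MeasurableSet {ω | X ω = a}) (F : A → ℝ) :
    Integrable (fun ω => F (X ω)) P := by
  rw [comp_eq_sum_indicator]
  exact integrable_finsetSum _ fun a _ => (integrable_const _).indicator (hX a)

lemma integral_comp_of_finite [IsProbabilityMeasure P]
    (hX : ∀ a, MeasurableSet {ω | X ω = a}) (F : A → ℝ) :
    ∫ ω, F (X ω) ∂P = ∑ a, P.real {ω | X ω = a} * F a := by
  rw [comp_eq_sum_indicator, integral_finsetSum _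
    fun a _ => (integrable_const _).indicator (hX a)]
  exact Finset.sum_congr rfl fun a _ => by rw [integral_indicator_const _ (hX a), smul_eq_mul]

lemma sum_measureReal_eq_one [IsProbabilityMeasure P]
    (hX : ∀ a, MeasurableSet {ω | X ω = a}) :
    ∑ a, P.real {ω | X ω = a} = 1 := by
  have := integral_comp_of_finite (P := P) hX fun _ => 1
  simpa using this.symm

variable {m : ℕ} {M : A → Fin m → ℤ} {w : Fin m → ℝ}

lemma maxWeight_pos {A : Type*} {X : Ω → A} {M : A → Fin m → ℤ} (hw : ∀ α, 0 ≤ w α)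
    {p : Fin m → ℤ → Prop} [∀ α, DecidablePred (p α)] {μ : ℝ}
    (hμ : ∫ ω, weightedCount w p (M (X ω)) ∂P = μ) (hμ0 : 0 < μ) : 0 < maxWeight w := by
  by_contra h
  have hw0 : ∀ α, w α = 0 := fun α => le_antisymm ((le_maxWeight w α).trans (not_lt.1 h)) (hw α)
  simp only [weightedCount, hw0, zero_mul, Finset.sum_const_zero, integral_zero] at hμ
  exact hμ0.ne hμ

theorem concentrationBounds_ge [IsProbabilityMeasure P]
    (hX : ∀ a, MeasurableSet {ω | X ω = a}) (hw : ∀ α, 0 ≤ w α)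
    (S : ∀ α, ColorSplit (fun a => P.real {ω | X ω = a}) M α) (d : Fin m → ℤ) {μ : ℝ}
    (hμ : ∫ ω, weightedCount w (fun α k => d α ≤ k) (M (X ω)) ∂P = μ) (hμ0 : 0 < μ) :
    ConcentrationBounds P (fun ω => weightedCount w (fun α k => d α ≤ k) (M (X ω))) μ
      (maxWeight w) := by
  have hc := maxWeight_pos hw hμ hμ0
  refine ConcentrationBounds.of_mgf_le hμ0 hc (fun θ => integrable_comp_of_finite hX fun a =>
    Real.exp (θ * weightedCount w (fun α k => d α ≤ k) (M a))) fun θ => ?_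
  rw [mgf, integral_comp_of_finite hX fun a =>
    Real.exp (θ * weightedCount w (fun α k => d α ≤ k) (M a))]
  refine sum_exp_weightedCount_ge_le hw (fun _ => measureReal_nonneg)
    (sum_measureReal_eq_one hX) S d hc ?_ θ
  rw [← hμ, integral_comp_of_finite hX fun a => weightedCount w (fun α k => d α ≤ k) (M a)]

theorem concentrationBounds_ne [IsProbabilityMeasure P]
    (hX : ∀ a, MeasurableSet {ω | X ω = a}) (hw : ∀ α, 0 ≤ w α)
    (S : ∀ α, ColorSplit (fun a => P.real {ω | X ω = a}) M α) (d : Fin m → ℤ) {μ : ℝ}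
    (hμ : ∫ ω, weightedCount w (fun α k => k ≠ d α) (M (X ω)) ∂P = μ) (hμ0 : 0 < μ) :
    ConcentrationBounds P (fun ω => weightedCount w (fun α k => k ≠ d α) (M (X ω))) μ
      (2 * maxWeight w) := by
  have hc : 0 < 2 * maxWeight w := mul_pos two_pos (maxWeight_pos hw hμ hμ0)
  refine ConcentrationBounds.of_mgf_le hμ0 hc (fun θ => integrable_comp_of_finite hX fun a =>
    Real.exp (θ * weightedCount w (fun α k => k ≠ d α) (M a))) fun θ => ?_
  rw [mgf, integral_comp_of_finite hX fun a =>
    Real.exp (θ * weightedCount w (fun α k => k ≠ d α) (M a))]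
  refine sum_exp_weightedCount_ne_le hw (sum_measureReal_eq_one hX) S d hc ?_ θ
  rw [← hμ, integral_comp_of_finite hX fun a => weightedCount w (fun α k => k ≠ d α) (M a)]

lemma integral_weightedCount [IsProbabilityMeasure P]
    (hX : ∀ a, MeasurableSet {ω | X ω = a}) {p : Fin m → ℤ → Prop}
    [∀ α, DecidablePred (p α)] :
    ∫ ω, weightedCount w p (M (X ω)) ∂P =
      ∑ α, w α * ∑ a, P.real {ω | X ω = a} * (if p α (M a α) then 1 else 0) := by
  rw [integral_comp_of_finite hX fun a => weightedCount w p (M a)]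
  have := sum_mul_weightedCount_mul (π := fun a => P.real {ω | X ω = a}) (M := M) (w := w) (p := p)
    fun _ => 1
  simpa using this

end FiniteRange

/-! ### The multinomial model -/

section Multinomial

variable {m n : ℕ}

/-- The number of balls in urn `α` when ball `j` is in urn `l j`. -/
def locCount (l : Fin n → Fin m) (α : Fin m) : ℤ := ((Finset.univ.filter fun j => l j = α).card : ℤ)

/-- The conditional probability that ball `j` is in urn `β`, given that it is not in urn `α`; the
point mass at `α` if that event has probability zero. -/
def condLoc (p : Fin m → Fin n → ℝ) (α β : Fin m) (j : Fin n) : ℝ :=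
  if p α j = 1 then (if β = α then 1 else 0) else if β = α then 0 else p β j / (1 - p α j)

variable {p : Fin m → Fin n → ℝ} {α : Fin m}

/-- The law of total probability. If `p α j = 1`, the conditional law is irrelevant, since its
weight is zero. -/
lemma condLoc_spec (hp : ∀ β j, 0 ≤ p β j) (hsum : ∀ j, ∑ β, p β j = 1) (β : Fin m) (j : Fin n) :
    (1 - p α j) * condLoc p α β j + p α j * (if β = α then 1 else 0) = p β j := by
  unfold condLoc
  by_cases h1 : p α j = 1
  · rw [if_pos h1]
    by_cases hβ : β = α
    · subst hβ
      simp [h1]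
    · have h2 : p α j + p β j ≤ ∑ γ, p γ j := by
        rw [← Finset.sum_pair (f := fun γ => p γ j) (Ne.symm hβ)]
        exact Finset.sum_le_sum_of_subset_of_nonneg (Finset.subset_univ _) fun γ _ _ => hp γ j
      rw [hsum j, h1] at h2
      have : p β j = 0 := le_antisymm (by linarith) (hp β j)
      simp [h1, hβ, this]
  · rw [if_neg h1]
    have h2 : 1 - p α j ≠ 0 := fun h => h1 (by linarith)
    by_cases hβ : β = α
    · subst hβ
      simp
    · rw [if_neg hβ, if_neg hβ]
      field_simp
      ring

lemma condLoc_self (j : Fin n) : (1 - p α j) * condLoc p α α j = 0 := by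
  unfold condLoc
  by_cases h1 : p α j = 1
  · simp [h1]
  · simp [h1]

lemma le_one_of_sum_eq_one (hp : ∀ β j, 0 ≤ p β j) (hsum : ∀ j, ∑ β, p β j = 1) (j : Fin n) :
    p α j ≤ 1 := by
  rw [← hsum j]
  exact Finset.single_le_sum (f := fun β => p β j) (fun β _ => hp β j) (Finset.mem_univ α)

lemma condLoc_nonneg (hp : ∀ β j, 0 ≤ p β j) (hsum : ∀ j, ∑ β, p β j = 1) (β : Fin m)
    (j : Fin n) : 0 ≤ condLoc p α β j := by
  have h1 : p α j ≤ 1 := le_one_of_sum_eq_one hp hsum j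
  unfold condLoc
  split_ifs
  · norm_num
  · norm_num
  · norm_num
  · exact div_nonneg (hp β j) (by linarith)

lemma sum_condLoc (hp : ∀ β j, 0 ≤ p β j) (hsum : ∀ j, ∑ β, p β j = 1) (j : Fin n) :
    ∑ β, condLoc p α β j = 1 := by
  by_cases h1 : p α j = 1
  · simp [condLoc, h1]
  · have h2 : 1 - p α j ≠ 0 := fun h => h1 (by linarith)
    have h3 := Finset.sum_congr (rfl : (Finset.univ : Finset (Fin m)) = Finset.univ)
      fun β _ => condLoc_spec (α := α) hp hsum β j
    rw [hsum j, Finset.sum_add_distrib, ← Finset.mul_sum, ← Finset.mul_sum] at h3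
    simp only [Finset.sum_ite_eq', Finset.mem_univ, if_true, mul_one] at h3
    exact mul_left_cancel₀ h2 (by linarith)

/-- The law of independent locations when those outside of `R` are replaced by `α`. -/
lemma sum_prod_mul_comp_ite {q : Fin m → Fin n → ℝ} (hq : ∀ j, ∑ β, q β j = 1)
    (R : Finset (Fin n)) (F : (Fin n → Fin m) → ℝ) :
    ∑ z : Fin n → Fin m, (∏ j, q (z j) j) * F (fun j => if j ∈ R then z j else α) =
      ∑ l : Fin n → Fin m, (∏ j ∈ R, q (l j) j) *
        (∏ j ∈ Finset.univ \ R, if l j = α then 1 else 0) * F l := by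
  have h1 : ∀ l : Fin n → Fin m, (∏ j ∈ R, q (l j) j) *
      (∏ j ∈ Finset.univ \ R, if l j = α then (1 : ℝ) else 0) =
      ∑ z : Fin n → Fin m, (∏ j, q (z j) j) *
        (if (fun j => if j ∈ R then z j else α) = l then 1 else 0) := by
    intro l
    have h2 : ∀ z : Fin n → Fin m, (∏ j, q (z j) j) *
        (if (fun j => if j ∈ R then z j else α) = l then (1 : ℝ) else 0) =
        ∏ j, q (z j) j * (if (if j ∈ R then z j else α) = l j then 1 else 0) := by
      intro z
      rw [Finset.prod_mul_distrib, Finset.prod_ite_zero]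
      simp [funext_iff]
    simp only [h2]
    have h3 := Finset.prod_univ_sum (fun _ : Fin n => (Finset.univ : Finset (Fin m)))
      fun j c => q c j * (if (if j ∈ R then c else α) = l j then (1 : ℝ) else 0)
    rw [Fintype.piFinset_univ] at h3
    rw [← h3, ← Finset.prod_sdiff (Finset.subset_univ R), mul_comm]
    congr 1
    · refine Finset.prod_congr rfl fun j hj => ?_
      simp only [Finset.mem_sdiff, Finset.mem_univ, true_and] at hj
      simp only [hj, if_false]
      rw [← Finset.sum_mul, hq j, one_mul]
      simp only [eq_comm]
    · refine Finset.prod_congr rfl fun j hj => ?_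
      simp [hj]
  simp only [h1, Finset.sum_mul]
  rw [Finset.sum_comm]
  refine Finset.sum_congr rfl fun z _ => ?_
  rw [Finset.sum_eq_single_of_mem (fun j => if j ∈ R then z j else α) (Finset.mem_univ _)]
  · simp
  · intro l _ hl
    rw [if_neg (Ne.symm hl)]
    ring

lemma locCount_ite {R : Finset (Fin n)} {z : Fin n → Fin m} (hz : ∀ j ∈ R, z j ≠ α) :
    locCount (fun j => if j ∈ R then z j else α) = splitCount (n : ℤ) z α R := by
  funext β
  unfold locCount splitCount
  by_cases hβ : β = α
  · subst hβ
    rw [if_pos rfl]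
    have h1 : (Finset.univ.filter fun j => (if j ∈ R then z j else β) = β) = Rᶜ := by
      ext j
      by_cases hj : j ∈ R
      · simp [hj, hz j hj]
      · simp [hj]
    rw [h1, Finset.card_compl, Fintype.card_fin, Nat.cast_sub]
    simpa using Finset.card_le_univ R
  · rw [if_neg hβ]
    congr 2
    ext j
    by_cases hj : j ∈ R
    · simp [hj]
    · simp [hj, Ne.symm hβ]

/-- The occupancy law splits along every urn. -/
def multinomialSplit (hp : ∀ β j, 0 ≤ p β j) (hsum : ∀ j, ∑ β, p β j = 1) (α : Fin m) :
    ColorSplit (fun l : Fin n → Fin m => ∏ j, p (l j) j) locCount α where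
  ι := Fin n
  decEq := inferInstance
  s := Finset.univ
  x j := 1 - p α j
  y j := p α j
  a _ := 1
  T := n
  ζ := Fin n → Fin m
  Z := Finset.univ
  ρ z := ∏ j, condLoc p α (z j) j
  loc z := z
  x_nonneg j _ := sub_nonneg.2 (le_one_of_sum_eq_one hp hsum j)
  y_nonneg j _ := hp α j
  a_nonneg _ := zero_le_one
  a_logConcave := IsLogConcave.one
  ρ_nonneg z _ := Finset.prod_nonneg fun j _ => condLoc_nonneg hp hsum _ j
  expect Φ := by
    -- Each factor splits by whether ball `j` avoids urn `α`; expanding the product, `R` collects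
    -- the balls that do.
    have h1 : ∀ l : Fin n → Fin m, ∏ j, p (l j) j = ∑ R ∈ Finset.univ.powerset,
        (∏ j ∈ R, (1 - p α j)) * (∏ j ∈ Finset.univ \ R, p α j) *
          ((∏ j ∈ R, condLoc p α (l j) j) *
            ∏ j ∈ Finset.univ \ R, if l j = α then 1 else 0) := by
      intro l
      rw [Finset.prod_congr rfl fun j _ => (condLoc_spec (α := α) hp hsum (l j) j).symm,
        Finset.prod_add]
      refine Finset.sum_congr rfl fun R _ => ?_
      rw [Finset.prod_mul_distrib, Finset.prod_mul_distrib]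
      ring
    simp only [h1, subsetSum, Finset.mul_sum, Finset.sum_mul]
    rw [Finset.sum_comm, Finset.sum_comm (s := Finset.univ)]
    refine Finset.sum_congr rfl fun R _ => ?_
    have h2 := sum_prod_mul_comp_ite (α := α) (fun j => sum_condLoc (α := α) hp hsum j) R
      fun l => Φ (locCount l)
    calc _ = (∏ j ∈ R, (1 - p α j)) * (∏ j ∈ Finset.univ \ R, p α j) *
          ∑ l : Fin n → Fin m, (∏ j ∈ R, condLoc p α (l j) j) *
            (∏ j ∈ Finset.univ \ R, if l j = α then 1 else 0) * Φ (locCount l) := by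
          rw [Finset.mul_sum]
          exact Finset.sum_congr rfl fun l _ => by ring
      _ = _ := by
          rw [← h2, Finset.mul_sum]
          refine Finset.sum_congr rfl fun z _ => ?_
          by_cases hz : ∀ j ∈ R, z j ≠ α
          · rw [locCount_ite hz]
            ring
          -- If `z` sends a ball of `R` to `α`, the two count vectors may differ, but the weight is
          -- zero on both sides by `condLoc_self`.
          · push Not at hz
            obtain ⟨j, hj, hjz⟩ := hz
            have h3 : (∏ j ∈ R, (1 - p α j)) * ∏ j, condLoc p α (z j) j = 0 := by
              rw [← Finset.prod_sdiff (Finset.subset_univ R), mul_left_comm,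
                ← Finset.prod_mul_distrib, Finset.prod_eq_zero hj, mul_zero]
              rw [hjz, condLoc_self]
            calc _ = ((∏ j ∈ R, (1 - p α j)) * ∏ j, condLoc p α (z j) j) *
                  ((∏ j ∈ Finset.univ \ R, p α j) *
                    Φ (locCount fun j => if j ∈ R then z j else α)) := by ring
              _ = ((∏ j ∈ R, (1 - p α j)) * ∏ j, condLoc p α (z j) j) *
                  ((∏ j ∈ Finset.univ \ R, p α j) * (1 * Φ (splitCount (n : ℤ) z α R))) := by
                  rw [h3, zero_mul, zero_mul]
              _ = _ := by ring

lemma sum_prod_mul_locCount_eq (hp : ∀ β j, 0 ≤ p β j) (hsum : ∀ j, ∑ β, p β j = 1) (α : Fin m)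
    (k : ℤ) :
    ∑ l : Fin n → Fin m, (∏ j, p (l j) j) * (if locCount l α = k then 1 else 0) =
      pbEq k (p α) := by
  have h1 : ∑ l : Fin n → Fin m, (∏ j, p (l j) j) * (if locCount l α = k then 1 else 0) =
      (∑ z : Fin n → Fin m, ∏ j, condLoc p α (z j) j) *
        subsetSum Finset.univ (fun j => 1 - p α j) (fun j => p α j)
          fun R => 1 * (if (n : ℤ) - R.card = k then 1 else 0) :=
    (multinomialSplit hp hsum α).expect_coord fun i => if i = k then 1 else 0
  have hρ : ∑ z : Fin n → Fin m, ∏ j, condLoc p α (z j) j = 1 := by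
    have h3 := Finset.prod_univ_sum (fun _ : Fin n => (Finset.univ : Finset (Fin m)))
      fun j c => condLoc p α c j
    rw [Fintype.piFinset_univ] at h3
    rw [← h3]
    exact Finset.prod_eq_one fun j _ => sum_condLoc hp hsum j
  rw [h1, hρ]
  simp only [one_mul, subsetSum, Finset.powerset_univ]
  rw [pbEq, Finset.sum_filter]
  -- `R` holds the balls outside urn `α`, while `pbEq` sums over the set inside it.
  refine Fintype.sum_equiv (Function.Involutive.toPerm compl compl_involutive) _ _ fun R => ?_
  have hc : ((Rᶜ).card : ℤ) = n - R.card := by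
    rw [Finset.card_compl, Fintype.card_fin, Nat.cast_sub]
    simpa using Finset.card_le_univ R
  rw [← Finset.compl_eq_univ_sdiff, Function.Involutive.coe_toPerm, hc, compl_compl]
  by_cases hk : (n : ℤ) - R.card = k
  · rw [if_pos hk, if_pos hk]
    ring
  · rw [if_neg hk, if_neg hk, mul_zero]

lemma sum_prod_mul_locCount_ge (hp : ∀ β j, 0 ≤ p β j) (hsum : ∀ j, ∑ β, p β j = 1) (α : Fin m)
    (d : ℤ) :
    ∑ l : Fin n → Fin m, (∏ j, p (l j) j) * (if d ≤ locCount l α then 1 else 0) =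
      pbGe d (p α) := by
  rw [pbGe, Finset.sum_congr rfl fun k _ => (sum_prod_mul_locCount_eq hp hsum α k).symm,
    Finset.sum_comm]
  refine Finset.sum_congr rfl fun l _ => ?_
  rw [← Finset.mul_sum, Finset.sum_ite_eq]
  have : locCount l α ≤ n := by
    unfold locCount
    exact_mod_cast (Finset.card_le_univ _).trans (Fintype.card_fin n).le
  simp [Finset.mem_Icc, this]

lemma sum_prod_mul_locCount_ne (hp : ∀ β j, 0 ≤ p β j) (hsum : ∀ j, ∑ β, p β j = 1) (α : Fin m)
    (d : ℤ) (h1 : ∑ l : Fin n → Fin m, ∏ j, p (l j) j = 1) :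
    ∑ l : Fin n → Fin m, (∏ j, p (l j) j) * (if locCount l α ≠ d then 1 else 0) =
      pbNe d (p α) := by
  rw [pbNe, ← sum_prod_mul_locCount_eq hp hsum α d, ← h1, ← Finset.sum_sub_distrib]
  refine Finset.sum_congr rfl fun l _ => ?_
  rw [h1]
  by_cases h : locCount l α = d <;> simp [h]

variable {Ω : Type*} [MeasurableSpace Ω] {P : Measure Ω}
  {L : Fin n → Ω → Fin m}

lemma IsMultinomialOccupancy.measurableSet_eq (h : IsMultinomialOccupancy P p L)
    (l : Fin n → Fin m) : MeasurableSet {ω | (fun j => L j ω) = l} := by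
  have h1 : {ω | (fun j => L j ω) = l} = ⋂ j, L j ⁻¹' {l j} := by
    ext ω
    simp [funext_iff]
  rw [h1]
  exact MeasurableSet.iInter fun j => h.measurable j (MeasurableSet.singleton _)

lemma IsMultinomialOccupancy.measureReal_eq (h : IsMultinomialOccupancy P p L)
    (l : Fin n → Fin m) : P.real {ω | (fun j => L j ω) = l} = ∏ j, p (l j) j := by
  have h1 : {ω | (fun j => L j ω) = l} = ⋂ j ∈ Finset.univ, L j ⁻¹' {l j} := by
    ext ω
    simp [funext_iff]
  rw [h1, measureReal_def, h.indep.measure_inter_preimage_eq_mul Finset.univ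
    fun j _ => MeasurableSet.singleton _, ENNReal.toReal_prod]
  exact Finset.prod_congr rfl fun j _ => h.law (l j) j

lemma IsMultinomialOccupancy.nonneg (h : IsMultinomialOccupancy P p L) (β : Fin m) (j : Fin n) :
    0 ≤ p β j := by
  rw [← h.law β j]
  exact measureReal_nonneg

lemma IsMultinomialOccupancy.sum_eq_one [IsProbabilityMeasure P]
    (h : IsMultinomialOccupancy P p L) (j : Fin n) :
    ∑ β, p β j = 1 := by
  rw [← sum_measureReal_eq_one (P := P) (X := L j)
    fun a => h.measurable j (MeasurableSet.singleton a)]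
  exact Finset.sum_congr rfl fun β _ => (h.law β j).symm

end Multinomial

/-! ### The hypergeometric model -/

section Hypergeometric

variable {m : ℕ} {N : Fin m → ℕ}

/-- The number of balls of color `α` in the set `B`. -/
def setColorCount (B : Finset (Ball N)) (α : Fin m) : ℤ := ((B.filter fun b => b.1 = α).card : ℤ)

lemma sum_finset_eq_sum_powerset_filter {β : Type*} [Fintype β] [DecidableEq β] (q : β → Prop)
    [DecidablePred q] (F : Finset β → ℝ) :
    ∑ B : Finset β, F B = ∑ R ∈ (Finset.univ.filter fun b => ¬ q b).powerset,
      ∑ C ∈ (Finset.univ.filter q).powerset, F (C ∪ R) := by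
  rw [← Finset.sum_product']
  refine Finset.sum_nbij' (fun B => (B.filter fun b => ¬ q b, B.filter q)) (fun x => x.2 ∪ x.1)
    ?_ ?_ ?_ ?_ ?_
  · intro B _
    simp only [Finset.mem_product, Finset.mem_powerset]
    exact ⟨Finset.filter_subset_filter _ (Finset.subset_univ B),
      Finset.filter_subset_filter _ (Finset.subset_univ B)⟩
  · simp
  · intro B _
    exact Finset.filter_union_filter_not_eq q B
  · rintro ⟨R, C⟩ h
    simp only [Finset.mem_product, Finset.mem_powerset] at h
    have hR : ∀ b ∈ R, ¬ q b := fun b hb => (Finset.mem_filter.1 (h.1 hb)).2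
    have hC : ∀ b ∈ C, q b := fun b hb => (Finset.mem_filter.1 (h.2 hb)).2
    ext b
    · simp only [Finset.mem_filter, Finset.mem_union]
      have := hR b
      have := hC b
      tauto
    · simp only [Finset.mem_filter, Finset.mem_union]
      have := hR b
      have := hC b
      tauto
  · intro B _
    rw [Finset.filter_union_filter_not_eq q B]

lemma levelSum_one_eq_choose {ι : Type*} [DecidableEq ι] (C : Finset ι) (k : ℕ) :
    levelSum C (fun _ => 1) (fun _ => 1) k (fun _ => 1) = C.card.choose k := by
  rw [← Finset.card_powersetCard, Finset.powersetCard_eq_filter, Finset.card_filter]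
  simp [levelSum, subsetSum]

lemma levelSum_of_neg {ι : Type*} [DecidableEq ι] {C : Finset ι} {x y : ι → ℝ} {k : ℤ}
    (hk : k < 0) (φ : Finset ι → ℝ) : levelSum C x y k φ = 0 := by
  refine Finset.sum_eq_zero fun R _ => ?_
  dsimp only
  rw [if_neg (by omega), mul_zero]

lemma setColorCount_union {α : Fin m} {s : ℕ} {R C : Finset (Ball N)} (hR : ∀ b ∈ R, b.1 ≠ α)
    (hC : ∀ b ∈ C, b.1 = α) (h : (C.card : ℤ) = s - R.card) :
    setColorCount (C ∪ R) = splitCount (s : ℤ) (fun b : Ball N => b.1) α R := by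
  funext β
  unfold setColorCount splitCount
  rw [Finset.filter_union]
  by_cases hβ : β = α
  · subst hβ
    rw [if_pos rfl, Finset.filter_true_of_mem hC, Finset.filter_false_of_mem hR,
      Finset.union_empty, h]
  · rw [if_neg hβ, Finset.filter_false_of_mem (s := C), Finset.empty_union]
    intro b hb hbβ
    exact hβ (hbβ.symm.trans (hC b hb))

/-- The law of a uniformly random set of `s` balls splits along every color. -/
def hypergeometricSplit {π : Finset (Ball N) → ℝ} {s : ℕ} {c : ℝ} (hc : 0 ≤ c)
    (hπ : ∀ B, π B = if B.card = s then c else 0) (α : Fin m) :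
    ColorSplit π setColorCount α where
  ι := Ball N
  decEq := inferInstance
  s := Finset.univ.filter fun b => ¬ b.1 = α
  x _ := 1
  y _ := 1
  -- This is the binomial coefficient of `N α` over `s - r`, counting the completions of `R` by
  -- balls of color `α`. The level-sum form gives log-concavity and vanishing out of range for free.
  a r := levelSum (Finset.univ.filter fun b : Ball N => b.1 = α) (fun _ => 1) (fun _ => 1)
    (s - r) fun _ => 1
  T := s
  ζ := Unit
  Z := Finset.univ
  ρ _ := c
  loc _ b := b.1
  x_nonneg _ _ := zero_le_one
  y_nonneg _ _ := zero_le_one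
  a_nonneg _ := levelSum_one_nonneg (fun _ _ => zero_le_one) fun _ _ => zero_le_one
  a_logConcave := (isLogConcave_levelSum (fun _ _ => zero_le_one) fun _ _ => zero_le_one).comp_sub s
  ρ_nonneg _ _ := hc
  expect Φ := by
    rw [sum_finset_eq_sum_powerset_filter (fun b : Ball N => b.1 = α)]
    simp only [Finset.univ_unique, Finset.sum_singleton, subsetSum, Finset.prod_const_one, one_mul,
      levelSum]
    rw [Finset.mul_sum]
    refine Finset.sum_congr rfl fun R hR => ?_
    rw [Finset.sum_mul, Finset.mul_sum]
    refine Finset.sum_congr rfl fun C hC => ?_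
    have hR' : ∀ b ∈ R, b.1 ≠ α := fun b hb =>
      (Finset.mem_filter.1 (Finset.mem_powerset.1 hR hb)).2
    have hC' : ∀ b ∈ C, b.1 = α := fun b hb =>
      (Finset.mem_filter.1 (Finset.mem_powerset.1 hC hb)).2
    have hd : Disjoint C R := Finset.disjoint_left.2 fun b hb hb' => hR' b hb' (hC' b hb)
    rw [hπ, Finset.card_union_of_disjoint hd]
    by_cases h : C.card + R.card = s
    · have h' : (C.card : ℤ) = s - R.card := by omega
      rw [if_pos h, if_pos h', setColorCount_union hR' hC' h']
      ring
    · have h' : ¬ (C.card : ℤ) = s - R.card := by omega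
      rw [if_neg h, if_neg h']
      ring

lemma card_filter_color (α : Fin m) :
    (Finset.univ.filter fun b : Ball N => b.1 = α).card = N α := by
  have h : (Finset.univ.filter fun b : Ball N => b.1 = α) =
      Finset.univ.map (Function.Embedding.sigmaMk α) := by
    ext ⟨β, i⟩
    simp only [Finset.mem_filter, Finset.mem_univ, true_and, Finset.mem_map,
      Function.Embedding.sigmaMk_apply]
    constructor
    · rintro rfl
      exact ⟨i, rfl⟩
    · rintro ⟨j, hj⟩
      exact (congrArg Sigma.fst hj).symm
  rw [h, Finset.card_map, Finset.card_univ, Fintype.card_fin]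

lemma card_ball : Fintype.card (Ball N) = ∑ α, N α := by
  simp [Ball]

lemma card_filter_ne_color (α : Fin m) :
    (Finset.univ.filter fun b : Ball N => ¬ b.1 = α).card = (∑ β, N β) - N α := by
  have h := Finset.card_filter_add_card_filter_not (s := (Finset.univ : Finset (Ball N)))
    (fun b : Ball N => b.1 = α)
  rw [card_filter_color, Finset.card_univ, card_ball] at h
  omega

/-- The law of the number of balls of color `α`. -/
lemma sum_mul_setColorCount {π : Finset (Ball N) → ℝ} {s : ℕ}
    (hπ : ∀ B, π B = if B.card = s then 1 / ((∑ α, N α).choose s : ℝ) else 0) (α : Fin m)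
    (f : ℤ → ℝ) :
    ∑ B, π B * f (setColorCount B α) =
      ∑ j ∈ Finset.range (s + 1), hyperQ j (N α) s (∑ β, N β) * f j := by
  have h1 := (hypergeometricSplit (by positivity) hπ α).expect_coord f
  rw [h1]
  simp only [hypergeometricSplit, Finset.univ_unique, Finset.sum_singleton]
  set D := Finset.univ.filter fun b : Ball N => ¬ b.1 = α with hD
  set C := Finset.univ.filter fun b : Ball N => b.1 = α with hC
  -- `I` contains both the possible cardinalities and all `s - j` with `j ≤ s`, negative ones
  -- included, so that the sum can be reindexed by `j`. On every other level one of the two factors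
  -- is zero.
  set I := (Finset.range (s + D.card + 1)).image (fun j : ℕ => (s : ℤ) - j) ∪
    Finset.Icc (0 : ℤ) (s + D.card) with hI
  have hmem : ∀ R ⊆ D, (R.card : ℤ) ∈ I := by
    intro R hR
    have := Finset.card_le_card hR
    refine Finset.mem_union_right _ (Finset.mem_Icc.2 ⟨by omega, by omega⟩)
  have e : ∀ R : Finset (Ball N), levelSum C (fun _ => 1) (fun _ => 1) (s - (R.card : ℤ))
      (fun _ => 1) * f (s - R.card) = (levelSum C (fun _ => 1) (fun _ => 1) (s - (R.card : ℤ))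
      (fun _ => 1) * f (s - R.card)) * 1 := fun R => (mul_one _).symm
  rw [subsetSum_congr (fun R _ => e R), subsetSum_eq_sum_levelSum hmem
    (fun r => levelSum C (fun _ => 1) (fun _ => 1) (s - r) (fun _ => 1) * f (s - r))
    (φ := fun _ => 1)]
  have hsub : (Finset.range (s + 1)).image (fun j : ℕ => (s : ℤ) - j) ⊆ I := by
    refine (Finset.image_subset_image ?_).trans Finset.subset_union_left
    intro j
    simp only [Finset.mem_range]
    omega
  rw [← Finset.sum_subset hsub, Finset.sum_image (by intro i _ j _ hij; simpa using hij),
    Finset.mul_sum]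
  · refine Finset.sum_congr rfl fun j hj => ?_
    have hjs : j ≤ s := by
      have := Finset.mem_range.1 hj
      omega
    have hN : N α ≤ ∑ β, N β := Finset.single_le_sum (fun β _ => Nat.zero_le _)
      (Finset.mem_univ α)
    rw [hyperQ, if_pos ⟨hjs, hN⟩, sub_sub_cancel, levelSum_one_eq_choose, ← Nat.cast_sub hjs,
      levelSum_one_eq_choose, hC, hD, card_filter_color, card_filter_ne_color]
    ring
  · intro r _ hr
    rcases lt_or_ge r 0 with h | h
    · rw [levelSum_of_neg h, mul_zero]
    · have : (s : ℤ) - r < 0 := by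
        by_contra h'
        refine hr (Finset.mem_image.2 ⟨((s : ℤ) - r).toNat, ?_, by omega⟩)
        rw [Finset.mem_range]
        omega
      rw [levelSum_of_neg this, zero_mul, zero_mul]

variable {Ω : Type*} [MeasurableSpace Ω] {P : Measure Ω} [IsProbabilityMeasure P] {s : ℕ}
  {S : Ω → Finset (Ball N)}

/-- The sets of size `s` already carry total mass `1`, so the remaining sets are null; `s ≤ ∑ α, N
α` keeps the binomial coefficient nonzero. -/
lemma IsHypergeometricSample.measureReal_eq (h : IsHypergeometricSample P N s S)
    (B : Finset (Ball N)) :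
    P.real {ω | S ω = B} = if B.card = s then 1 / ((∑ α, N α).choose s : ℝ) else 0 := by
  split_ifs with hB
  · exact h.law B hB
  · have h1 := sum_measureReal_eq_one (P := P) h.measurable
    rw [← Finset.sum_filter_add_sum_filter_not Finset.univ (fun B : Finset (Ball N) => B.card = s),
      Finset.sum_congr rfl fun B hB => h.law B (Finset.mem_filter.1 hB).2, Finset.sum_const,
      Finset.univ_filter_card_eq, Finset.card_powersetCard, Finset.card_univ, card_ball,
      nsmul_eq_mul, mul_one_div_cancel, add_eq_left] at h1
    · exact (Finset.sum_eq_zero_iff_of_nonneg fun _ _ => measureReal_nonneg).1 h1 B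
        (Finset.mem_filter.2 ⟨Finset.mem_univ _, hB⟩)
    · exact_mod_cast (Nat.choose_pos h.size_le).ne'

end Hypergeometric

end Occupancy

end

theorem theorem1p4 {Ω : Type*} [MeasurableSpace Ω] (P : Measure Ω) [IsProbabilityMeasure P]
    (m : ℕ) (w : Fin m → ℝ) (hw : ∀ α, 0 ≤ w α) (d : Fin m → ℤ) :
    -- multinomial occupancy
    (∀ (n : ℕ) (p : Fin m → Fin n → ℝ) (L : Fin n → Ω → Fin m),
      Occupancy.IsMultinomialOccupancy P p L →
        (∫ ω, Occupancy.Yge w d (Occupancy.urnCount L) ω ∂P = Occupancy.multinomialMeanGe w d p ∧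
          (0 < Occupancy.multinomialMeanGe w d p →
            Occupancy.ConcentrationBounds P (Occupancy.Yge w d (Occupancy.urnCount L))
              (Occupancy.multinomialMeanGe w d p) (Occupancy.maxWeight w))) ∧
        (∫ ω, Occupancy.Yne w d (Occupancy.urnCount L) ω ∂P = Occupancy.multinomialMeanNe w d p ∧
          (0 < Occupancy.multinomialMeanNe w d p →
            Occupancy.ConcentrationBounds P (Occupancy.Yne w d (Occupancy.urnCount L))
              (Occupancy.multinomialMeanNe w d p) (2 * Occupancy.maxWeight w)))) ∧
    -- multivariate hypergeometric sampling
    (∀ (N : Fin m → ℕ) (s : ℕ) (S : Ω → Finset (Occupancy.Ball N)),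
      Occupancy.IsHypergeometricSample P N s S →
        (∫ ω, Occupancy.Yge w d (Occupancy.colorCount S) ω ∂P = Occupancy.hyperMeanGe w d N s ∧
          (0 < Occupancy.hyperMeanGe w d N s →
            Occupancy.ConcentrationBounds P (Occupancy.Yge w d (Occupancy.colorCount S))
              (Occupancy.hyperMeanGe w d N s) (Occupancy.maxWeight w))) ∧
        (∫ ω, Occupancy.Yne w d (Occupancy.colorCount S) ω ∂P = Occupancy.hyperMeanNe w d N s ∧
          (0 < Occupancy.hyperMeanNe w d N s →
            Occupancy.ConcentrationBounds P (Occupancy.Yne w d (Occupancy.colorCount S))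
              (Occupancy.hyperMeanNe w d N s) (2 * Occupancy.maxWeight w)))) := by
  refine ⟨fun n p L h => ?_, fun N s S h => ?_⟩
  · have hX := h.measurableSet_eq
    have hp := h.nonneg
    have hsum := h.sum_eq_one
    have hlaw : (fun l : Fin n → Fin m => P.real {ω | (fun j => L j ω) = l}) =
        fun l => ∏ j, p (l j) j := funext h.measureReal_eq
    have hone : ∑ l : Fin n → Fin m, ∏ j, p (l j) j = 1 := by
      rw [← Occupancy.sum_measureReal_eq_one (P := P) hX]
      exact Finset.sum_congr rfl fun l _ => (h.measureReal_eq l).symm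
    have hge : ∫ ω, Occupancy.Yge w d (Occupancy.urnCount L) ω ∂P =
        Occupancy.multinomialMeanGe w d p := by
      -- `Yge` of the urn counts unfolds to `weightedCount` of `locCount`, applied to the vector of
      -- locations.
      refine (Occupancy.integral_weightedCount (M := Occupancy.locCount) hX).trans ?_
      refine Finset.sum_congr rfl fun α _ => ?_
      simp only [h.measureReal_eq]
      rw [Occupancy.sum_prod_mul_locCount_ge hp hsum]
    have hne : ∫ ω, Occupancy.Yne w d (Occupancy.urnCount L) ω ∂P =
        Occupancy.multinomialMeanNe w d p := by
      refine (Occupancy.integral_weightedCount (M := Occupancy.locCount)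
        (p := fun α k => k ≠ d α) hX).trans ?_
      refine Finset.sum_congr rfl fun α _ => ?_
      simp only [h.measureReal_eq]
      rw [Occupancy.sum_prod_mul_locCount_ne hp hsum _ _ hone]
    exact ⟨⟨hge, Occupancy.concentrationBounds_ge hX hw
        (fun α => hlaw ▸ Occupancy.multinomialSplit hp hsum α) d hge⟩,
      ⟨hne, Occupancy.concentrationBounds_ne hX hw
        (fun α => hlaw ▸ Occupancy.multinomialSplit hp hsum α) d hne⟩⟩
  · have hX := h.measurable
    have hlaw := h.measureReal_eq
    have hmean : ∀ (q : Fin m → ℤ → Prop) [∀ α, DecidablePred (q α)],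
        ∫ ω, Occupancy.weightedCount w q (Occupancy.setColorCount (S ω)) ∂P =
          ∑ α, w α * ∑ j ∈ (Finset.range (s + 1)).filter (fun j : ℕ => q α (j : ℤ)),
            Occupancy.hyperQ j (N α) s (∑ β, N β) := by
      intro q _
      rw [Occupancy.integral_weightedCount hX]
      refine Finset.sum_congr rfl fun α _ => ?_
      rw [Occupancy.sum_mul_setColorCount hlaw α fun k => if q α k then 1 else 0,
        Finset.sum_filter]
      simp only [mul_ite, mul_one, mul_zero]
    have hge : ∫ ω, Occupancy.Yge w d (Occupancy.colorCount S) ω ∂P =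
        Occupancy.hyperMeanGe w d N s := hmean fun α k => d α ≤ k
    have hne : ∫ ω, Occupancy.Yne w d (Occupancy.colorCount S) ω ∂P =
        Occupancy.hyperMeanNe w d N s := hmean fun α k => k ≠ d α
    exact ⟨⟨hge, Occupancy.concentrationBounds_ge hX hw
        (Occupancy.hypergeometricSplit (by positivity) hlaw) d hge⟩,
      ⟨hne, Occupancy.concentrationBounds_ne hX hw
        (Occupancy.hypergeometricSplit (by positivity) hlaw) d hne⟩⟩
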